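/- All categories and functors are enriched in the category $\mathsf{Pos}$ of posets: hom-sets are posets, composition is monotone, and functors are locally monotone. A weight $W\colon\mathcal D\to\mathsf{Pos}$ is \emph{finite} if $\mathcal D$ has finitely many isomorphism classes of objects and all $\mathcal D(d,d')$ and $Wd$ are finite. A \emph{(weak) $W$-weighted limit} of $D\colon\mathcal D\to\mathcal C$ is an object $L$ with a natural transformation $W\to\mathcal C(L,D-)$ such that for all $X$ the induced map $\mathcal C(X,L)\to[\mathcal D,\mathsf{Pos}](W,\mathcal C(X,D-))$ is an isomorphism of posets (respectively, for a weak limit, a surjection). A category is \emph{lex} (\emph{weakly lex}) if it has all limits (weak limits) with finite weights. A morphism $m$ is an \emph{order-mono} if $mh\le mh'$ implies $h\le h'$. A morphism $e\colon A\to B$ is an \emph{$\mathsf{so}$-morphism} if for every order-mono $m\colon X\to Y$ the square with corners $\mathcal C(B,X)$, $\mathcal C(A,X)$, $\mathcal C(B,Y)$, $\mathcal C(A,Y)$ given by precomposing with $e$ and postcomposing with $m$ is a pullback in $\mathsf{Pos}$. A morphism is an \emph{effective epimorphism} if it is the coinserter of some parallel pair. A category is \emph{regular} if it is lex, every morphism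 factors as an $\mathsf{so}$-morphism followed by an order-mono, and $\mathsf{so}$-morphisms are stable under pullback; it is \emph{exact} if moreover every congruence (a relation $R\rightarrowtail X\times X$ that is reflexive, transitive and an order-ideal) is the comma object $f/f$ of some morphism $f$ with itself. A functor is \emph{regular} if it preserves finite weighted limits and $\mathsf{so}$-morphisms. A functor $F\colon\mathcal C\to\mathcal E$ from a weakly lex to a regular category is \emph{left covering} if for every finite weight $W$, every diagram $D$ in $\mathcal C$ and every weak limit $\{W,D\}_w$, the canonical morphism $F\{W,D\}_w\to\{W,FD\}$ is an effective epimorphism. Let $\mathcal C$ be weakly lex. The category $\mathcal C_{\mathrm{ex}}$ has as objects $(X,R)$ the \emph{pseudocongruences} of $\mathcal C$: parallel pairs $r_0,r_1\colon R\rightrightarrows X$ such that every pair $a_0\le a_1\colon A\to X$ factors through $(r_0,r_1)$ and such that, for a weak pullback $d_0,d_1\colon R*R\rightrightarrows R$ of $r_1$ and $r_0$ (so $r_1d_0=r_0d_1$), there is $\tau\colon R*R\to R$ with $r_0\tau=r_0d_0$ and $r_1\tau=r_1d_1$. Morphisms $[f]\colon(X,R)\to(Y,S)$ are classes of those $f\colon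 X\to Y$ for which there is $\bar f\colon R\to S$ with $s_i\bar f=fr_i$ ($i=0,1$), where $[f]\le[g]$ iff there is $\Sigma\colon X\to S$ with $s_0\Sigma=f$ and $s_1\Sigma=g$, and $[f]=[g]$ iff $[f]\le[g]\le[f]$. Choose for each $X\in\mathcal C$ a weak comma square $I_X\rightrightarrows X$ of $(1_X,1_X)$, and let $\Gamma\colon\mathcal C\to\mathcal C_{\mathrm{ex}}$, $\Gamma X=(X,I_X)$, $\Gamma f=[f]$. \textbf{Theorem.} For every weakly lex category $\mathcal C$ and every such choice of the $I_X$, the functor $\Gamma$ is fully order-faithful (surjective and order-reflecting on hom-posets), and for every left covering functor $F\colon\mathcal C\to\mathcal E$ into an exact category $\mathcal E$ there is a regular functor $\overline F\colon\mathcal C_{\mathrm{ex}}\to\mathcal E$ with an isomorphism $\alpha\colon\overline F\circ\Gamma\cong F$, and it is unique up to isomorphism: for every regular functor $G\colon\mathcal C_{\mathrm{ex}}\to\mathcal E$ with an isomorphism $\beta\colon G\circ\Gamma\cong F$ there is an isomorphism $\theta\colon\overline F\cong G$ with $\beta\cdot\theta\Gamma=\alpha$. -/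

import Mathlib

universe v u v' u'

open CategoryTheory

namespace PosEnriched

/-! ### Poset-enriched categories and functors -/

/-- A category enriched in partially ordered sets: the hom-sets are partially ordered and
composition is monotone in both variables. -/
class PosCategory (C : Type u) [Category.{v} C] where
  [homOrder : ∀ X Y : C, PartialOrder (X ⟶ Y)]
  comp_mono : ∀ {X Y Z : C} {f f' : X ⟶ Y} {g g' : Y ⟶ Z}, f ≤ f' → g ≤ g' → f ≫ g ≤ f' ≫ g'

attribute [reducible, instance] PosCategory.homOrder

/-- A poset-enriched functor: a functor which is locally monotone. -/
structure PosFunctor (C : Type u) [Category.{v} C] [PosCategory C]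
    (D : Type u') [Category.{v'} D] [PosCategory D] extends Functor C D where
  map_mono : ∀ {X Y : C} {f g : X ⟶ Y}, f ≤ g → map f ≤ map g

/-- Composition of poset-enriched functors. -/
def PosFunctor.comp {C : Type*} [Category* C] [PosCategory C] {D : Type*} [Category* D]
    [PosCategory D] {E : Type*} [Category* E] [PosCategory E]
    (F : PosFunctor C D) (G : PosFunctor D E) : PosFunctor C E where
  toFunctor := F.toFunctor ⋙ G.toFunctor
  map_mono h := G.map_mono (F.map_mono h)

/-- `F` is fully order-faithful: it is surjective and order-reflecting on hom-posets. -/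
def PosFunctor.FullyOrderFaithful {C : Type*} [Category* C] [PosCategory C] {D : Type*}
    [Category* D] [PosCategory D] (F : PosFunctor C D) : Prop :=
  ∀ X Y : C, (∀ h : F.obj X ⟶ F.obj Y, ∃ f : X ⟶ Y, F.map f = h) ∧
    ∀ f g : X ⟶ Y, F.map f ≤ F.map g → f ≤ g

/-- The category of posets, enriched in itself by the pointwise order of monotone maps. -/
instance : PosCategory PartOrd.{u} where
  homOrder _ _ := PartialOrder.lift (fun f => f.hom) (fun _ _ h => PartOrd.hom_ext h)
  comp_mono {_ _ _ f _ _ g'} hf hg x := (hg (f.hom x)).trans (g'.hom.monotone (hf x))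

/-- Every ordinary category is poset-enriched by the discrete order on hom-sets. -/
@[reducible] def PosCategory.discrete (C : Type u) [Category.{v} C] : PosCategory C where
  homOrder _ _ :=
    { le := fun f g => f = g
      le_refl := fun _ => rfl
      le_trans := fun _ _ _ => Eq.trans
      le_antisymm := fun _ _ h _ => h }
  comp_mono := by rintro _ _ _ _ _ _ _ rfl rfl; rfl

/-! ### Weighted limits and weak weighted limits -/

section Weighted

variable {D : Type} [Category.{0} D] [PosCategory D]

/-- Finite weights: finitely many isomorphism classes of objects, finite hom-posets and
finite values. -/
def IsFiniteWeight (W : PosFunctor D PartOrd.{0}) : Prop :=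
  Finite (Quotient (isIsomorphicSetoid D)) ∧ (∀ d d' : D, Finite (d ⟶ d')) ∧
    ∀ d : D, Finite (W.obj d)

variable {C : Type u} [Category.{v} C] [PosCategory C]

/-- A `W`-weighted cone on `K` with vertex `X`: a natural transformation `W ⟶ C(X, K -)`
with monotone components, i.e. an element of `[D, Pos](W, C(X, K -))`. -/
@[ext]
structure WCone (W : PosFunctor D PartOrd.{0}) (K : PosFunctor D C) (X : C) where
  leg : ∀ d : D, W.obj d → (X ⟶ K.obj d)
  leg_mono : ∀ d : D, Monotone (leg d)
  naturality : ∀ {d d' : D} (k : d ⟶ d') (w : W.obj d),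
    leg d' ((W.map k).hom w) = leg d w ≫ K.map k

variable {W : PosFunctor D PartOrd.{0}} {K : PosFunctor D C}

/-- Weighted cones with a given vertex are ordered pointwise. -/
instance (X : C) : LE (WCone W K X) :=
  ⟨fun s t => ∀ (d : D) (w : W.obj d), s.leg d w ≤ t.leg d w⟩

/-- Precomposition of a weighted cone with a morphism into its vertex. -/
def WCone.precomp {X Y : C} (c : WCone W K X) (u : Y ⟶ X) : WCone W K Y where
  leg d w := u ≫ c.leg d w
  leg_mono d _ _ h := PosCategory.comp_mono le_rfl (c.leg_mono d h)
  naturality k w := by rw [c.naturality, Category.assoc]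

/-- The image of a weighted cone under a poset-enriched functor. -/
def WCone.map {E : Type u'} [Category.{v'} E] [PosCategory E] {X : C} (c : WCone W K X)
    (F : PosFunctor C E) : WCone W (K.comp F) (F.obj X) where
  leg d w := F.map (c.leg d w)
  leg_mono d _ _ h := F.map_mono (c.leg_mono d h)
  naturality k w := by rw [c.naturality, F.map_comp]; rfl

/-- `c` is a weak weighted limit: `C(X, L) → [D, Pos](W, C(X, K -))` is surjective for all `X`. -/
def WCone.IsWeakLimit {L : C} (c : WCone W K L) : Prop :=
  ∀ X : C, Function.Surjective (fun u : X ⟶ L => c.precomp u)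

/-- `c` is a weighted limit: `C(X, L) → [D, Pos](W, C(X, K -))` is an isomorphism of posets
for all `X` (it is always monotone). -/
def WCone.IsLimit {L : C} (c : WCone W K L) : Prop :=
  ∀ X : C, Function.Surjective (fun u : X ⟶ L => c.precomp u) ∧
    ∀ u v : X ⟶ L, c.precomp u ≤ c.precomp v → u ≤ v

end Weighted

section Cat

variable (C : Type u) [Category.{v} C] [PosCategory C]

/-- `C` is weakly lex: it has weak limits for all finite weights. -/
class WeaklyLex : Prop where
  exists_weakLimit : ∀ {D : Type} [Category.{0} D] [PosCategory D] (W : PosFunctor D PartOrd.{0})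
    (K : PosFunctor D C), IsFiniteWeight W → ∃ (L : C) (c : WCone W K L), c.IsWeakLimit

/-- `C` is lex: it has limits for all finite weights. -/
def IsLex : Prop :=
  ∀ {D : Type} [Category.{0} D] [PosCategory D] (W : PosFunctor D PartOrd.{0})
    (K : PosFunctor D C), IsFiniteWeight W → ∃ (L : C) (c : WCone W K L), c.IsLimit

end Cat

/-! ### Some limits and colimits in elementary form -/

section Shapes

variable {C : Type u} [Category.{v} C] [PosCategory C]

/-- The pair `(c₀, c₁)` reflects the order jointly. -/
def JointlyOrderMono {P X Y : C} (c₀ : P ⟶ X) (c₁ : P ⟶ Y) : Prop :=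
  ∀ ⦃A : C⦄ (h h' : A ⟶ P), h ≫ c₀ ≤ h' ≫ c₀ → h ≫ c₁ ≤ h' ≫ c₁ → h ≤ h'

/-- A weak pullback square of `f` and `g`. -/
def IsWeakPullback {P X Y Z : C} (p₀ : P ⟶ X) (p₁ : P ⟶ Y) (f : X ⟶ Z) (g : Y ⟶ Z) : Prop :=
  p₀ ≫ f = p₁ ≫ g ∧ ∀ ⦃A : C⦄ (u₀ : A ⟶ X) (u₁ : A ⟶ Y), u₀ ≫ f = u₁ ≫ g →
    ∃ u : A ⟶ P, u ≫ p₀ = u₀ ∧ u ≫ p₁ = u₁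

/-- A (poset-enriched) pullback square of `f` and `g`. -/
def IsPosPullback {P X Y Z : C} (p₀ : P ⟶ X) (p₁ : P ⟶ Y) (f : X ⟶ Z) (g : Y ⟶ Z) : Prop :=
  IsWeakPullback p₀ p₁ f g ∧ JointlyOrderMono p₀ p₁

/-- A weak comma square of the ordered pair `(f, g)`. -/
def IsWeakComma {P X Y Z : C} (c₀ : P ⟶ X) (c₁ : P ⟶ Y) (f : X ⟶ Z) (g : Y ⟶ Z) : Prop :=
  c₀ ≫ f ≤ c₁ ≫ g ∧ ∀ ⦃A : C⦄ (u₀ : A ⟶ X) (u₁ : A ⟶ Y), u₀ ≫ f ≤ u₁ ≫ g →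
    ∃ u : A ⟶ P, u ≫ c₀ = u₀ ∧ u ≫ c₁ = u₁

/-- A comma square of the ordered pair `(f, g)`. -/
def IsComma {P X Y Z : C} (c₀ : P ⟶ X) (c₁ : P ⟶ Y) (f : X ⟶ Z) (g : Y ⟶ Z) : Prop :=
  IsWeakComma c₀ c₁ f g ∧ JointlyOrderMono c₀ c₁

/-- `q` is a coinserter of the ordered pair `(f, g)`. -/
def IsCoinserter {X Y Q : C} (f g : X ⟶ Y) (q : Y ⟶ Q) : Prop :=
  f ≫ q ≤ g ≫ q ∧ (∀ ⦃Z : C⦄ (h : Y ⟶ Z), f ≫ h ≤ g ≫ h → ∃ u : Q ⟶ Z, q ≫ u = h) ∧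
    ∀ ⦃Z : C⦄ (u v : Q ⟶ Z), q ≫ u ≤ q ≫ v → u ≤ v

/-- An effective epimorphism: a coinserter of some pair. -/
def IsEffectiveEpi {Y Q : C} (q : Y ⟶ Q) : Prop :=
  ∃ (X : C) (f g : X ⟶ Y), IsCoinserter f g q

/-- An order-monomorphism (`ff`-morphism). -/
def OrderMono {X Y : C} (m : X ⟶ Y) : Prop :=
  ∀ ⦃Z : C⦄ (h h' : Z ⟶ X), h ≫ m ≤ h' ≫ m → h ≤ h'

/-- An `so`-morphism: for every order-mono `m : X ⟶ Y` the poset `C(B, X)` is, via `- ∘ e` and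
`m ∘ -`, the pullback of `C(A, X) → C(A, Y) ← C(B, Y)` in posets. -/
def IsSo {A B : C} (e : A ⟶ B) : Prop :=
  ∀ ⦃X Y : C⦄ (m : X ⟶ Y), OrderMono m →
    (∀ (a : A ⟶ X) (b : B ⟶ Y), a ≫ m = e ≫ b → ∃ w : B ⟶ X, e ≫ w = a ∧ w ≫ m = b) ∧
    ∀ w w' : B ⟶ X, e ≫ w ≤ e ≫ w' → w ≫ m ≤ w' ≫ m → w ≤ w'

/-- A congruence on `X`: a relation `(r₀, r₁) : R ↣ X × X` which is reflexive, transitive and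
an order-ideal, in terms of generalized elements. -/
structure IsCongruence {R X : C} (r₀ r₁ : R ⟶ X) : Prop where
  orderMono : JointlyOrderMono r₀ r₁
  refl : ∀ ⦃A : C⦄ (x : A ⟶ X), ∃ t : A ⟶ R, t ≫ r₀ = x ∧ t ≫ r₁ = x
  trans : ∀ ⦃A : C⦄ (a b : A ⟶ R), a ≫ r₁ = b ≫ r₀ →
    ∃ t : A ⟶ R, t ≫ r₀ = a ≫ r₀ ∧ t ≫ r₁ = b ≫ r₁
  ideal : ∀ ⦃A : C⦄ (a : A ⟶ R) (x' y' : A ⟶ X), x' ≤ a ≫ r₀ → a ≫ r₁ ≤ y' →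
    ∃ t : A ⟶ R, t ≫ r₀ = x' ∧ t ≫ r₁ = y'

end Shapes

/-! ### Regular and exact categories, left covering and regular functors -/

section Exact

variable (C : Type u) [Category.{v} C] [PosCategory C]

/-- Regular categories: finite limits, (`so`, order-mono)-factorizations, and stability of
`so`-morphisms under pullback. -/
structure IsRegularCat : Prop where
  lex : IsLex C
  factor : ∀ ⦃X Y : C⦄ (f : X ⟶ Y), ∃ (I : C) (e : X ⟶ I) (m : I ⟶ Y),
    IsSo e ∧ OrderMono m ∧ e ≫ m = f
  stable : ∀ ⦃P X Y Z : C⦄ (p₀ : P ⟶ X) (p₁ : P ⟶ Y) (f : X ⟶ Z) (g : Y ⟶ Z),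
    IsPosPullback p₀ p₁ f g → IsSo g → IsSo p₀

/-- Exact categories: regular categories in which every congruence is effective, i.e. is the
kernel congruence of some morphism. -/
structure IsExactCat : Prop where
  regular : IsRegularCat C
  effective : ∀ ⦃R X : C⦄ (r₀ r₁ : R ⟶ X), IsCongruence r₀ r₁ →
    ∃ (Y : C) (f : X ⟶ Y), IsComma r₀ r₁ f f

variable {C} {E : Type u'} [Category.{v'} E] [PosCategory E]

/-- Left covering functors: for every weak finite limit `c` of a diagram `K` in `C`, the
canonical factorization `q` of the image of `c` through the limit `m` of the image of `K`
is an effective epimorphism. -/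
def PosFunctor.IsLeftCovering (F : PosFunctor C E) : Prop :=
  ∀ {D : Type} [Category.{0} D] [PosCategory D] (W : PosFunctor D PartOrd.{0})
    (K : PosFunctor D C), IsFiniteWeight W →
    ∀ (L : C) (c : WCone W K L), c.IsWeakLimit →
    ∀ (M : E) (m : WCone W (K.comp F) M), m.IsLimit →
    ∀ q : F.obj L ⟶ M, m.precomp q = c.map F → IsEffectiveEpi q

/-- Regular functors: those preserving finite limits and `so`-morphisms. -/
structure PosFunctor.IsRegular (F : PosFunctor C E) : Prop where
  map_limit : ∀ {D : Type} [Category.{0} D] [PosCategory D] (W : PosFunctor D PartOrd.{0})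
    (K : PosFunctor D C), IsFiniteWeight W →
    ∀ (L : C) (c : WCone W K L), c.IsLimit → (c.map F).IsLimit
  map_so : ∀ ⦃X Y : C⦄ (e : X ⟶ Y), IsSo e → IsSo (F.map e)

end Exact

/-! ### Two weak limits in a weakly lex category -/

section WeaklyLex

variable {C : Type u} [Category.{v} C] [PosCategory C]

/-- A weakly lex category has weak pullbacks. -/
theorem exists_weakPullback [WeaklyLex C] {X Y Z : C} (f : X ⟶ Z) (g : Y ⟶ Z) :
    ∃ (P : C) (p₀ : P ⟶ X) (p₁ : P ⟶ Y), IsWeakPullback p₀ p₁ f g := by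
  let _ : PosCategory Limits.WalkingCospan := PosCategory.discrete _
  let W : PosFunctor Limits.WalkingCospan PartOrd.{0} :=
    { toFunctor := (Functor.const _).obj (PartOrd.of PUnit)
      map_mono := fun _ => le_rfl }
  let K : PosFunctor Limits.WalkingCospan C :=
    { toFunctor := Limits.cospan f g
      map_mono := fun {_ _ a b} h => by
        have h' : a = b := h
        rw [h'] }
  have hW : IsFiniteWeight W :=
    ⟨inferInstance, fun d d' => inferInstance, fun d => inferInstanceAs (Finite PUnit)⟩
  obtain ⟨L, c, hc⟩ := WeaklyLex.exists_weakLimit W K hW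
  have hl : c.leg .one PUnit.unit = c.leg .left PUnit.unit ≫ f :=
    c.naturality Limits.WalkingCospan.Hom.inl PUnit.unit
  have hr : c.leg .one PUnit.unit = c.leg .right PUnit.unit ≫ g :=
    c.naturality Limits.WalkingCospan.Hom.inr PUnit.unit
  refine ⟨L, c.leg .left PUnit.unit, c.leg .right PUnit.unit, hl.symm.trans hr, ?_⟩
  intro A u₀ u₁ h
  let s : WCone W K A :=
    { leg := fun d _ => match d with
        | .left => u₀
        | .right => u₁
        | .one => u₀ ≫ f
      leg_mono := fun d _ _ _ => le_rfl
      naturality := by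
        intro d d' k w
        rcases k with _ | (_ | _)
        · exact ((congrArg (_ ≫ ·) (K.map_id _)).trans (Category.comp_id _)).symm
        · rfl
        · exact h }
  obtain ⟨u, hu⟩ := hc A s
  exact ⟨u, congrArg (fun t => t.leg .left PUnit.unit) hu,
    congrArg (fun t => t.leg .right PUnit.unit) hu⟩

/-- A weakly lex category has weak comma squares of pairs of identities. -/
theorem exists_weakComma_id [WeaklyLex C] (X : C) :
    ∃ (P : C) (i₀ i₁ : P ⟶ X), IsWeakComma i₀ i₁ (𝟙 X) (𝟙 X) := by
  let _ : PosCategory (Discrete PUnit.{1}) := PosCategory.discrete _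
  let W : PosFunctor (Discrete PUnit.{1}) PartOrd.{0} :=
    { toFunctor := (Functor.const _).obj (PartOrd.of Bool)
      map_mono := fun _ => le_rfl }
  let K : PosFunctor (Discrete PUnit.{1}) C :=
    { toFunctor := (Functor.const _).obj X
      map_mono := fun _ => le_rfl }
  have hW : IsFiniteWeight W :=
    ⟨inferInstance, fun d d' => inferInstance, fun d => inferInstanceAs (Finite Bool)⟩
  obtain ⟨L, c, hc⟩ := WeaklyLex.exists_weakLimit W K hW
  refine ⟨L, c.leg ⟨⟨⟩⟩ false, c.leg ⟨⟨⟩⟩ true,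
    PosCategory.comp_mono (c.leg_mono ⟨⟨⟩⟩ Bool.false_lt_true.le) le_rfl, ?_⟩
  intro A u₀ u₁ h
  rw [Category.comp_id, Category.comp_id] at h
  let s : WCone W K A :=
    { leg := fun _ (b : Bool) => match b with
        | false => u₀
        | true => u₁
      leg_mono := by
        rintro d (_ | _) (_ | _) hb
        · exact le_rfl
        · exact h
        · exact absurd (show true ≤ false from hb) (by simp)
        · exact le_rfl
      naturality := fun _ _ => (Category.comp_id _).symm }
  obtain ⟨u, hu⟩ := hc A s
  exact ⟨u, congrArg (fun t => t.leg ⟨⟨⟩⟩ false) hu, congrArg (fun t => t.leg ⟨⟨⟩⟩ true) hu⟩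

end WeaklyLex

/-! ### The exact completion -/

section Completion

/-- A pseudocongruence `r₀, r₁ : R ⇉ X` in `C`. -/
structure Pseudocongruence (C : Type u) [Category.{v} C] [PosCategory C] where
  X : C
  R : C
  r₀ : R ⟶ X
  r₁ : R ⟶ X
  orderRefl : ∀ ⦃A : C⦄ (a₀ a₁ : A ⟶ X), a₀ ≤ a₁ → ∃ u : A ⟶ R, u ≫ r₀ = a₀ ∧ u ≫ r₁ = a₁
  trans : ∃ (P : C) (d₀ d₁ : P ⟶ R), IsWeakPullback d₀ d₁ r₁ r₀ ∧
    ∃ τ : P ⟶ R, τ ≫ r₀ = d₀ ≫ r₀ ∧ τ ≫ r₁ = d₁ ≫ r₁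

variable {C : Type u} [Category.{v} C] [PosCategory C]

/-- The morphisms `f : X ⟶ Y` of `C` which represent a morphism `(X, R) ⟶ (Y, S)`. -/
def PreHom (S T : Pseudocongruence C) : Type v :=
  { f : S.X ⟶ T.X // ∃ f' : S.R ⟶ T.R, f' ≫ T.r₀ = S.r₀ ≫ f ∧ f' ≫ T.r₁ = S.r₁ ≫ f }

/-- The preorder on representing morphisms: `f ≼ g` if `(f, g)` factors through the target. -/
instance (S T : Pseudocongruence C) : Preorder (PreHom S T) where
  le f g := ∃ σ : S.X ⟶ T.R, σ ≫ T.r₀ = f.1 ∧ σ ≫ T.r₁ = g.1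
  le_refl f := T.orderRefl f.1 f.1 le_rfl
  le_trans f g h := by
    rintro ⟨σ, hσ₀, hσ₁⟩ ⟨ρ, hρ₀, hρ₁⟩
    obtain ⟨P, d₀, d₁, ⟨-, hP⟩, τ, hτ₀, hτ₁⟩ := T.trans
    obtain ⟨u, hu₀, hu₁⟩ := hP σ ρ (hσ₁.trans hρ₀.symm)
    refine ⟨u ≫ τ, ?_, ?_⟩
    · rw [Category.assoc, hτ₀, ← Category.assoc, hu₀, hσ₀]
    · rw [Category.assoc, hτ₁, ← Category.assoc, hu₁, hρ₁]

/-- Composition of representing morphisms. -/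
def PreHom.comp {S T U : Pseudocongruence C} (f : PreHom S T) (g : PreHom T U) : PreHom S U :=
  ⟨f.1 ≫ g.1, by
    obtain ⟨f, f', h₀, h₁⟩ := f
    obtain ⟨g, g', k₀, k₁⟩ := g
    refine ⟨f' ≫ g', ?_, ?_⟩
    · exact (Category.assoc _ _ _).trans ((congrArg (f' ≫ ·) k₀).trans (by
        simp only [← Category.assoc, h₀]))
    · exact (Category.assoc _ _ _).trans ((congrArg (f' ≫ ·) k₁).trans (by
        simp only [← Category.assoc, h₁]))⟩

theorem PreHom.comp_le_comp {S T U : Pseudocongruence C} {f f' : PreHom S T} {g g' : PreHom T U}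
    (hf : f ≤ f') (hg : g ≤ g') : f.comp g ≤ f'.comp g' := by
  obtain ⟨σ, hσ₀, hσ₁⟩ := hf
  obtain ⟨ρ, hρ₀, hρ₁⟩ := hg
  refine le_trans (b := f'.comp g) ?_ ?_
  · obtain ⟨k, k₀, k₁⟩ := g.2
    refine ⟨σ ≫ k, ?_, ?_⟩
    · rw [Category.assoc, k₀, ← Category.assoc, hσ₀]; rfl
    · rw [Category.assoc, k₁, ← Category.assoc, hσ₁]; rfl
  · refine ⟨f'.1 ≫ ρ, ?_, ?_⟩
    · rw [Category.assoc, hρ₀]; rfl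
    · rw [Category.assoc, hρ₁]; rfl

variable (C) in
/-- The exact completion of `C`: objects are pseudocongruences, morphisms are equivalence classes
of representing morphisms for the equivalence relation induced by `≼`. -/
abbrev ExCompletion : Type (max u v) := Pseudocongruence C

instance : Category.{v} (ExCompletion C) where
  Hom S T := Antisymmetrization (PreHom S T) (· ≤ ·)
  id S := toAntisymmetrization (· ≤ ·)
    (⟨𝟙 S.X, 𝟙 S.R, by simp, by simp⟩ : PreHom S S)
  comp := Quotient.map₂ PreHom.comp fun _ _ hf _ _ hg =>
    ⟨PreHom.comp_le_comp hf.1 hg.1, PreHom.comp_le_comp hf.2 hg.2⟩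
  id_comp := by
    rintro S T ⟨f⟩
    exact congrArg (toAntisymmetrization (· ≤ ·)) (Subtype.ext (Category.id_comp f.1))
  comp_id := by
    rintro S T ⟨f⟩
    exact congrArg (toAntisymmetrization (· ≤ ·)) (Subtype.ext (Category.comp_id f.1))
  assoc := by
    rintro S T U V ⟨f⟩ ⟨g⟩ ⟨h⟩
    exact congrArg (toAntisymmetrization (· ≤ ·)) (Subtype.ext (Category.assoc f.1 g.1 h.1))

/-- The class `[f] : (X, R) ⟶ (Y, S)` of a representing morphism. -/
def ExCompletion.homMk {S T : ExCompletion C} (f : S.X ⟶ T.X)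
    (hf : ∃ f' : S.R ⟶ T.R, f' ≫ T.r₀ = S.r₀ ≫ f ∧ f' ≫ T.r₁ = S.r₁ ≫ f) : S ⟶ T :=
  toAntisymmetrization (· ≤ ·) (⟨f, hf⟩ : PreHom S T)

/-- Hom-sets of the exact completion are ordered by `[f] ≤ [g]` iff `f ≼ g`. -/
instance : PosCategory (ExCompletion C) where
  homOrder S T := inferInstanceAs (PartialOrder (Antisymmetrization (PreHom S T) (· ≤ ·)))
  comp_mono := by
    rintro S T U ⟨f⟩ ⟨f'⟩ ⟨g⟩ ⟨g'⟩ hf hg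
    exact PreHom.comp_le_comp hf hg

/-- A weak comma square `I_X ⇉ X` of the pair `(𝟙 X, 𝟙 X)`. -/
structure WeakCommaId (X : C) where
  I : C
  i₀ : I ⟶ X
  i₁ : I ⟶ X
  isWeakComma : IsWeakComma i₀ i₁ (𝟙 X) (𝟙 X)

/-- In a weakly lex category a choice of weak comma squares `I_X` exists. -/
theorem nonempty_weakCommaId [WeaklyLex C] : Nonempty (∀ X : C, WeakCommaId X) :=
  ⟨fun X =>
    let h := exists_weakComma_id X
    ⟨h.choose, h.choose_spec.choose, h.choose_spec.choose_spec.choose,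
      h.choose_spec.choose_spec.choose_spec⟩⟩

theorem WeakCommaId.le {X : C} (i : WeakCommaId X) : i.i₀ ≤ i.i₁ := by
  simpa only [Category.comp_id] using i.isWeakComma.1

theorem WeakCommaId.exists_lift {X : C} (i : WeakCommaId X) {A : C} (a₀ a₁ : A ⟶ X)
    (h : a₀ ≤ a₁) : ∃ u : A ⟶ i.I, u ≫ i.i₀ = a₀ ∧ u ≫ i.i₁ = a₁ :=
  i.isWeakComma.2 a₀ a₁ (by simpa only [Category.comp_id] using h)

/-- The object `(X, I_X)` of the exact completion. -/
def WeakCommaId.pseudocongruence [WeaklyLex C] {X : C} (i : WeakCommaId X) : ExCompletion C where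
  X := X
  R := i.I
  r₀ := i.i₀
  r₁ := i.i₁
  orderRefl _ a₀ a₁ h := i.exists_lift a₀ a₁ h
  trans := by
    obtain ⟨P, d₀, d₁, hP⟩ := exists_weakPullback i.i₁ i.i₀
    refine ⟨P, d₀, d₁, hP, i.exists_lift _ _ ?_⟩
    calc d₀ ≫ i.i₀ ≤ d₀ ≫ i.i₁ := PosCategory.comp_mono le_rfl i.le
      _ = d₁ ≫ i.i₀ := hP.1
      _ ≤ d₁ ≫ i.i₁ := PosCategory.comp_mono le_rfl i.le

/-- The canonical functor `Γ : C ⥤ C_ex`, `X ↦ (X, I_X)`, `f ↦ [f]`, for a choice `I` of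
weak comma squares. -/
def Γ [WeaklyLex C] (I : ∀ X : C, WeakCommaId X) : PosFunctor C (ExCompletion C) where
  obj X := (I X).pseudocongruence
  map {X Y} f := ExCompletion.homMk (S := (I X).pseudocongruence) (T := (I Y).pseudocongruence) f
    ((I Y).exists_lift ((I X).i₀ ≫ f) ((I X).i₁ ≫ f)
      (PosCategory.comp_mono (I X).le le_rfl))
  map_id _ := rfl
  map_comp _ _ := rfl
  map_mono {_ Y f g} h := (I Y).exists_lift f g h

end Completion

end PosEnriched

open PosEnriched

/-! A regular extension of `F` has no choice on objects. In `C_ex` the morphism `(X, I_X) ⟶ (X, R)`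
represented by the identity is an `so`-morphism (`isSo_cover`), and its kernel is covered by `(R,
I_R)` (`exists_comma_cover`). A regular extension therefore sends `(X, R)` to the quotient of `F X`
by the image of `F R`, in the sense of `IsQuotient`. Such quotients have a universal property, so
two regular extensions are canonically isomorphic. Conversely, the extension is built by choosing
these quotients.

The working tool is local reasoning: statements about generalized elements of `E` are checked after
passing to an `so`-cover. Left covering then says that a finite system of inequalities solved over
`F` in `E` is locally the image of one solved in `C` (`exists_local_solution`). The same holds for
systems of constraints of the form "related by a pseudocongruence", because witnesses can be added
as further unknowns (`exists_local_relSolution`). Consequently the image of `F R` in `F X × F X` is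
a congruence and has a quotient by exactness.

The extension preserves `so`-morphisms because in `C_ex` they have sections in `C` up to the target
relation (`exists_section_of_isSo`). It preserves finite limits because joint order-monicity is
inherited from `C_ex` (`le_of_forall_comp_map_le`) and cones lift locally to cones with vertex in
the image of `Γ` (`exists_local_cone`). Finally, `Γ` is fully order-faithful because `I_X` relates
two generalized elements exactly when they are ordered (`rel_iff`). -/

namespace PosEnriched

open Limits

/-! ### Finite systems of inequalities as weighted diagrams -/

section Systems

/-- Walking multicospans are poset-enriched by the discrete order. -/
instance (J : MulticospanShape.{0, 0}) : PosCategory (WalkingMulticospan J) :=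
  PosCategory.discrete _

theorem finite_walkingMulticospan (J : MulticospanShape.{0, 0}) [Finite J.L] [Finite J.R] :
    Finite (WalkingMulticospan J) :=
  Finite.of_surjective (Sum.elim WalkingMulticospan.left WalkingMulticospan.right) (by
    rintro (l | r)
    exacts [⟨.inl l, rfl⟩, ⟨.inr r, rfl⟩])

theorem finite_walkingMulticospan_hom (J : MulticospanShape.{0, 0}) [Finite J.L] [Finite J.R]
    (a b : WalkingMulticospan J) : Finite (a ⟶ b) := by
  have := finite_walkingMulticospan J
  let T := Σ (a b : WalkingMulticospan J), (a ⟶ b)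
  let g : WalkingMulticospan J ⊕ J.R ⊕ J.R → T := fun s => match s with
    | .inl a => ⟨a, a, 𝟙 a⟩
    | .inr (.inl r) => ⟨_, _, WalkingMulticospan.Hom.fst r⟩
    | .inr (.inr r) => ⟨_, _, WalkingMulticospan.Hom.snd r⟩
  have hg : Function.Surjective g := by
    rintro ⟨a, b, (_ | r | r)⟩
    exacts [⟨.inl a, rfl⟩, ⟨.inr (.inl r), rfl⟩, ⟨.inr (.inr r), rfl⟩]
  have : Finite T := Finite.of_surjective g hg
  exact Finite.of_injective (fun k : a ⟶ b => (⟨a, b, k⟩ : T)) fun k k' h => by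
    injection h with _ h
    exact sigma_mk_injective h

/-- The weight on a walking multicospan whose cones are solutions of systems of inequalities. -/
def ineqWeight (J : MulticospanShape.{0, 0}) : PosFunctor (WalkingMulticospan J) PartOrd.{0} where
  obj d := match d with
    | .left _ => PartOrd.of PUnit
    | .right _ => PartOrd.of Bool
  map {_ _} k := match k with
    | .id _ => 𝟙 _
    -- The two arrows into a right node pick the bottom and the top of `Bool`, so monotonicity of a
    -- leg there is exactly one inequality.
    | .fst _ => PartOrd.ofHom ⟨fun _ => false, fun _ _ _ => le_rfl⟩
    | .snd _ => PartOrd.ofHom ⟨fun _ => true, fun _ _ _ => le_rfl⟩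
  map_id _ := rfl
  map_comp := by
    rintro _ _ _ (_ | _ | _) (_ | _ | _) <;> rfl
  map_mono := by
    rintro _ _ _ _ rfl
    exact le_rfl

theorem isFiniteWeight_ineqWeight (J : MulticospanShape.{0, 0}) [Finite J.L] [Finite J.R] :
    IsFiniteWeight (ineqWeight J) := by
  have := finite_walkingMulticospan J
  refine ⟨inferInstance, finite_walkingMulticospan_hom J, ?_⟩
  rintro (l | r)
  exacts [inferInstanceAs (Finite PUnit), inferInstanceAs (Finite Bool)]

variable {C : Type u} [Category.{v} C] [PosCategory C]

theorem comp_le_left {X Y Z : C} (f : X ⟶ Y) {g g' : Y ⟶ Z} (hg : g ≤ g') : f ≫ g ≤ f ≫ g' :=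
  PosCategory.comp_mono le_rfl hg

theorem comp_le_right {X Y Z : C} {f f' : X ⟶ Y} (hf : f ≤ f') (g : Y ⟶ Z) : f ≫ g ≤ f' ≫ g :=
  PosCategory.comp_mono hf le_rfl

variable {J : MulticospanShape.{0, 0}}

/-- The poset-enriched diagram given by a multicospan. -/
def ineqDiagram (S : MulticospanIndex J C) : PosFunctor (WalkingMulticospan J) C where
  toFunctor := S.multicospan
  map_mono := by
    rintro _ _ _ _ rfl
    exact le_rfl

/-- The weighted cone given by a solution of a system of inequalities. -/
def ineqCone (K : PosFunctor (WalkingMulticospan J) C) {A : C}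
    (y : ∀ l, A ⟶ K.obj (.left l))
    (h : ∀ r, y (J.fst r) ≫ K.map (WalkingMulticospan.Hom.fst r) ≤
      y (J.snd r) ≫ K.map (WalkingMulticospan.Hom.snd r)) : WCone (ineqWeight J) K A where
  leg d := match d with
    | .left l => fun _ => y l
    | .right r => fun (b : Bool) => match b with
      | false => y (J.fst r) ≫ K.map (WalkingMulticospan.Hom.fst r)
      | true => y (J.snd r) ≫ K.map (WalkingMulticospan.Hom.snd r)
  leg_mono := by
    rintro (l | r)
    · exact fun _ _ _ => le_rfl
    · rintro (_ | _) (_ | _) hb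
      · exact le_rfl
      · exact h r
      · exact absurd (show true ≤ false from hb) (by simp)
      · exact le_rfl
  naturality := by
    rintro _ _ (_ | r | r) w
    · exact ((congrArg (_ ≫ ·) (K.map_id _)).trans (Category.comp_id _)).symm
    · rfl
    · rfl

variable {K : PosFunctor (WalkingMulticospan J) C}

/-- The solution underlying a weighted cone. -/
def WCone.sol {A : C} (c : WCone (ineqWeight J) K A) (l : J.L) : A ⟶ K.obj (.left l) :=
  c.leg (.left l) PUnit.unit

theorem WCone.leg_right_false {A : C} (c : WCone (ineqWeight J) K A) (r : J.R) :
    c.leg (.right r) false = c.sol (J.fst r) ≫ K.map (WalkingMulticospan.Hom.fst r) :=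
  c.naturality (WalkingMulticospan.Hom.fst r) PUnit.unit

theorem WCone.leg_right_true {A : C} (c : WCone (ineqWeight J) K A) (r : J.R) :
    c.leg (.right r) true = c.sol (J.snd r) ≫ K.map (WalkingMulticospan.Hom.snd r) :=
  c.naturality (WalkingMulticospan.Hom.snd r) PUnit.unit

theorem WCone.sol_le {A : C} (c : WCone (ineqWeight J) K A) (r : J.R) :
    c.sol (J.fst r) ≫ K.map (WalkingMulticospan.Hom.fst r) ≤
      c.sol (J.snd r) ≫ K.map (WalkingMulticospan.Hom.snd r) := by
  rw [← c.leg_right_false, ← c.leg_right_true]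
  exact c.leg_mono (.right r) (show false ≤ true from Bool.false_le _)

theorem WCone.le_of_sol_le {A : C} {c c' : WCone (ineqWeight J) K A}
    (h : ∀ l, c.sol l ≤ c'.sol l) : c ≤ c' := by
  rintro (l | r) w
  · exact h l
  · change Bool at w
    cases w
    · rw [c.leg_right_false, c'.leg_right_false]
      exact comp_le_right (h _) _
    · rw [c.leg_right_true, c'.leg_right_true]
      exact comp_le_right (h _) _

theorem WCone.le_antisymm {D : Type} [Category.{0} D] [PosCategory D]
    {W : PosFunctor D PartOrd.{0}} {K : PosFunctor D C} {A : C} {c c' : WCone W K A}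
    (h : c ≤ c') (h' : c' ≤ c) : c = c' :=
  WCone.ext (funext fun d => funext fun w => _root_.le_antisymm (h d w) (h' d w))

theorem WCone.ext_sol {A : C} {c c' : WCone (ineqWeight J) K A}
    (h : ∀ l, c.sol l = c'.sol l) : c = c' :=
  le_antisymm (le_of_sol_le fun l => (h l).le) (le_of_sol_le fun l => (h l).ge)

/-- The families `y` solving the system of inequalities given by a multicospan. -/
def IsSolution (S : MulticospanIndex J C) {A : C} (y : ∀ l, A ⟶ S.left l) : Prop :=
  ∀ r, y (J.fst r) ≫ S.fst r ≤ y (J.snd r) ≫ S.snd r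

theorem exists_weakUniversal_solution [WeaklyLex C] [Finite J.L] [Finite J.R]
    (S : MulticospanIndex J C) :
    ∃ (P : C) (x : ∀ l, P ⟶ S.left l), IsSolution S x ∧
      ∀ ⦃A : C⦄ (y : ∀ l, A ⟶ S.left l), IsSolution S y → ∃ u : A ⟶ P, ∀ l, u ≫ x l = y l := by
  obtain ⟨P, c, hc⟩ := WeaklyLex.exists_weakLimit (ineqWeight J) (ineqDiagram S)
    (isFiniteWeight_ineqWeight J)
  refine ⟨P, c.sol, c.sol_le, fun A y hy => ?_⟩
  obtain ⟨u, hu⟩ := hc A (ineqCone (ineqDiagram S) y hy)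
  exact ⟨u, fun l => congrArg (fun t => WCone.sol t l) hu⟩

/-- Source of the products, pullbacks and inserters below; an equation is imposed as two opposite
inequalities. -/
theorem exists_universal_solution (hC : IsLex C) [Finite J.L] [Finite J.R]
    (S : MulticospanIndex J C) :
    ∃ (P : C) (x : ∀ l, P ⟶ S.left l), IsSolution S x ∧
      (∀ ⦃A : C⦄ (y : ∀ l, A ⟶ S.left l), IsSolution S y → ∃ u : A ⟶ P, ∀ l, u ≫ x l = y l) ∧
      ∀ ⦃A : C⦄ (u u' : A ⟶ P), (∀ l, u ≫ x l ≤ u' ≫ x l) → u ≤ u' := by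
  obtain ⟨P, c, hc⟩ := hC (ineqWeight J) (ineqDiagram S) (isFiniteWeight_ineqWeight J)
  refine ⟨P, c.sol, c.sol_le, fun A y hy => ?_, fun A u u' h => ?_⟩
  · obtain ⟨u, hu⟩ := (hc A).1 (ineqCone (ineqDiagram S) y hy)
    exact ⟨u, fun l => congrArg (fun t => WCone.sol t l) hu⟩
  · exact (hc A).2 u u' (WCone.le_of_sol_le h)

/-- A universal solution of a system of inequalities is a weighted limit. -/
theorem isLimit_ineqCone {S : MulticospanIndex J C} {P : C} {x : ∀ l, P ⟶ S.left l}
    (hx : IsSolution S x)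
    (lift : ∀ ⦃A : C⦄ (y : ∀ l, A ⟶ S.left l), IsSolution S y →
      ∃ u : A ⟶ P, ∀ l, u ≫ x l = y l)
    (mono : ∀ ⦃A : C⦄ (u u' : A ⟶ P), (∀ l, u ≫ x l ≤ u' ≫ x l) → u ≤ u') :
    (ineqCone (ineqDiagram S) x hx).IsLimit := by
  refine fun A => ⟨fun c => ?_, fun u u' h => mono u u' fun l => h (.left l) PUnit.unit⟩
  obtain ⟨u, hu⟩ := lift c.sol c.sol_le
  exact ⟨u, WCone.ext_sol hu⟩

variable {E : Type u'} [Category.{v'} E] [PosCategory E]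

/-- The image of a system of inequalities under a functor. -/
def mapSystem (F : C ⥤ E) (S : MulticospanIndex J C) : MulticospanIndex J E where
  left l := F.obj (S.left l)
  right r := F.obj (S.right r)
  fst r := F.map (S.fst r)
  snd r := F.map (S.snd r)

theorem PosFunctor.IsRegular.exists_lift {F : PosFunctor C E} (hF : F.IsRegular)
    [Finite J.L] [Finite J.R] {S : MulticospanIndex J C} {P : C} {x : ∀ l, P ⟶ S.left l}
    (hx : IsSolution S x)
    (lift : ∀ ⦃A : C⦄ (y : ∀ l, A ⟶ S.left l), IsSolution S y →
      ∃ u : A ⟶ P, ∀ l, u ≫ x l = y l)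
    (mono : ∀ ⦃A : C⦄ (u u' : A ⟶ P), (∀ l, u ≫ x l ≤ u' ≫ x l) → u ≤ u')
    {A : E} (y : ∀ l, A ⟶ F.obj (S.left l)) (hy : IsSolution (mapSystem F.toFunctor S) y) :
    ∃ u : A ⟶ F.obj P, ∀ l, u ≫ F.map (x l) = y l := by
  obtain ⟨u, hu⟩ := (hF.map_limit _ _ (isFiniteWeight_ineqWeight J) _ _
    (isLimit_ineqCone hx lift mono) A).1 (ineqCone ((ineqDiagram S).comp F) y hy)
  exact ⟨u, fun l => congrArg (fun t => WCone.sol t l) hu⟩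

end Systems

/-! ### Effective epimorphisms and `so`-morphisms -/

section So

variable {C : Type u} [Category.{v} C] [PosCategory C]

/-- If `q` is the coinserter of `(f, g)`, the order-mono `m` reflects `f ≫ a ≤ g ≫ a` from `f ≫ q ≤
g ≫ q`, so `a` descends along `q`. This is all that is needed of effective epimorphisms. -/
theorem IsEffectiveEpi.isSo {Y Q : C} {q : Y ⟶ Q} (hq : IsEffectiveEpi q) : IsSo q := by
  obtain ⟨Z, f, g, hfg, hq₁, hq₂⟩ := hq
  refine fun X X' m hm => ⟨fun a b h => ?_, fun w w' h _ => hq₂ w w' h⟩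
  obtain ⟨w, hw⟩ := hq₁ a (hm _ _ (by
    simpa only [Category.assoc, h] using comp_le_right hfg b))
  have hw' : q ≫ w ≫ m = q ≫ b := by rw [← Category.assoc, hw, h]
  exact ⟨w, hw, _root_.le_antisymm (hq₂ _ _ hw'.le) (hq₂ _ _ hw'.ge)⟩

theorem isSo_id (X : C) : IsSo (𝟙 X) := fun _ _ m _ =>
  ⟨fun a b h => ⟨a, Category.id_comp a, h.trans (Category.id_comp b)⟩,
    fun w w' h _ => by simpa only [Category.id_comp] using h⟩

theorem OrderMono.eq_of_comp_eq {X Y Z : C} {m : X ⟶ Y} (hm : OrderMono m) {h h' : Z ⟶ X}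
    (e : h ≫ m = h' ≫ m) : h = h' :=
  le_antisymm (hm _ _ e.le) (hm _ _ e.ge)

/-- As `m` is order-monic, the other triangle and order-uniqueness follow from the triangle over
`Y`. -/
theorem isSo_of_lift {A B : C} {e : A ⟶ B}
    (h : ∀ ⦃X Y : C⦄ (m : X ⟶ Y), OrderMono m → ∀ (a : A ⟶ X) (b : B ⟶ Y), a ≫ m = e ≫ b →
      ∃ w : B ⟶ X, w ≫ m = b) : IsSo e := by
  refine fun X Y m hm => ⟨fun a b hab => ?_, fun w w' _ hw => hm _ _ hw⟩
  obtain ⟨w, hw⟩ := h m hm a b hab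
  exact ⟨w, hm.eq_of_comp_eq (by rw [Category.assoc, hw, hab]), hw⟩

theorem IsSo.exists_lift {A B X Y : C} {e : A ⟶ B} (he : IsSo e) {m : X ⟶ Y} (hm : OrderMono m)
    {a : A ⟶ X} {b : B ⟶ Y} (h : a ≫ m = e ≫ b) : ∃ w : B ⟶ X, w ≫ m = b :=
  let ⟨w, _, hw⟩ := (he m hm).1 a b h
  ⟨w, hw⟩

theorem IsSo.comp {X Y Z : C} {e : X ⟶ Y} {e' : Y ⟶ Z} (he : IsSo e) (he' : IsSo e') :
    IsSo (e ≫ e') := by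
  refine isSo_of_lift fun _ _ m hm a b h => ?_
  obtain ⟨w, hw⟩ := he.exists_lift hm (h.trans (Category.assoc _ _ _))
  exact he'.exists_lift hm hw

theorem IsSo.of_comp {X Y Z : C} {e : X ⟶ Y} {e' : Y ⟶ Z} (he : IsSo (e ≫ e')) : IsSo e' :=
  isSo_of_lift fun _ _ m hm a b h =>
    he.exists_lift hm (a := e ≫ a) (by rw [Category.assoc, h, Category.assoc])

theorem isSo_of_iso {X Y : C} (i : X ≅ Y) : IsSo i.hom :=
  isSo_of_lift fun _ _ m _ a b h => ⟨i.inv ≫ a, by rw [Category.assoc, h, i.inv_hom_id_assoc]⟩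

/-- A morphism which is both an `so`-morphism and an order-mono has an inverse. -/
theorem IsSo.exists_inverse {X Y : C} {e : X ⟶ Y} (he : IsSo e) (hm : OrderMono e) :
    ∃ w : Y ⟶ X, e ≫ w = 𝟙 X ∧ w ≫ e = 𝟙 Y := by
  obtain ⟨w, h₁, h₂⟩ := (he e hm).1 (𝟙 X) (𝟙 Y) (by simp)
  exact ⟨w, h₁, h₂⟩

end So

/-! ### Local reasoning in regular categories -/

section Regular

variable {E : Type u} [Category.{v} E] [PosCategory E]

theorem IsLex.exists_prod (hE : IsLex E) (X Y : E) :
    ∃ (P : E) (p₀ : P ⟶ X) (p₁ : P ⟶ Y), JointlyOrderMono p₀ p₁ ∧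
      ∀ ⦃A : E⦄ (a : A ⟶ X) (b : A ⟶ Y), ∃ u : A ⟶ P, u ≫ p₀ = a ∧ u ≫ p₁ = b := by
  let J : MulticospanShape.{0, 0} := ⟨Bool, Empty, Empty.elim, Empty.elim⟩
  have : Finite J.L := inferInstanceAs (Finite Bool)
  have : Finite J.R := inferInstanceAs (Finite Empty)
  let S : MulticospanIndex J E :=
    ⟨fun l => Bool.rec X Y l, fun r => r.elim, fun r => r.elim, fun r => r.elim⟩
  obtain ⟨P, x, -, lift, mono⟩ := exists_universal_solution hE S
  refine ⟨P, x false, x true, fun A h h' h₀ h₁ => mono h h' ?_, fun A a b => ?_⟩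
  · rintro (_ | _)
    exacts [h₀, h₁]
  · obtain ⟨u, hu⟩ := lift (A := A) (fun l => Bool.rec a b l) (fun r => r.elim)
    exact ⟨u, hu false, hu true⟩

theorem IsLex.exists_pullback (hE : IsLex E) {X Y Z : E} (f : X ⟶ Z) (g : Y ⟶ Z) :
    ∃ (P : E) (p₀ : P ⟶ X) (p₁ : P ⟶ Y), IsPosPullback p₀ p₁ f g := by
  let J : MulticospanShape.{0, 0} := ⟨Bool, Bool, id, not⟩
  have : Finite J.L := inferInstanceAs (Finite Bool)
  have : Finite J.R := inferInstanceAs (Finite Bool)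
  let k : ∀ l : Bool, (Bool.rec X Y l : E) ⟶ Z := fun l => match l with
    | false => f
    | true => g
  let S : MulticospanIndex J E := ⟨fun l => Bool.rec X Y l, fun r => Z, fun r => k r,
    fun r => k (not r)⟩
  obtain ⟨P, x, hx, lift, mono⟩ := exists_universal_solution hE S
  refine ⟨P, x false, x true, ⟨le_antisymm (hx false) (hx true), fun A a b h => ?_⟩,
    fun A h h' h₀ h₁ => mono h h' ?_⟩
  · obtain ⟨u, hu⟩ := lift (A := A) (fun l => Bool.rec a b l) (by
      rintro (_ | _)
      exacts [h.le, h.ge])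
    exact ⟨u, hu false, hu true⟩
  · rintro (_ | _)
    exacts [h₀, h₁]

theorem IsLex.exists_inserter (hE : IsLex E) {X Y : E} (f g : X ⟶ Y) :
    ∃ (P : E) (p : P ⟶ X), OrderMono p ∧ p ≫ f ≤ p ≫ g ∧
      ∀ ⦃A : E⦄ (a : A ⟶ X), a ≫ f ≤ a ≫ g → ∃ u : A ⟶ P, u ≫ p = a := by
  let J : MulticospanShape.{0, 0} := ⟨Unit, Unit, id, id⟩
  have : Finite J.L := inferInstanceAs (Finite Unit)
  have : Finite J.R := inferInstanceAs (Finite Unit)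
  let S : MulticospanIndex J E := ⟨fun _ => X, fun _ => Y, fun _ => f, fun _ => g⟩
  obtain ⟨P, x, hx, lift, mono⟩ := exists_universal_solution hE S
  refine ⟨P, x (), fun A h h' h₀ => mono h h' fun _ => h₀, hx (), fun A a h => ?_⟩
  obtain ⟨u, hu⟩ := lift (A := A) (fun _ => a) (fun _ => h)
  exact ⟨u, hu ()⟩

/-- `so`-morphisms are order-epimorphisms. -/
theorem IsSo.le_of_comp_le (hE : IsLex E) {X Y Z : E} {e : X ⟶ Y} (he : IsSo e) {a b : Y ⟶ Z}
    (h : e ≫ a ≤ e ≫ b) : a ≤ b := by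
  -- `e` factors through the inserter of `a` and `b`, which is order-monic; the diagonal is then a
  -- section of the inserter, which forces `a ≤ b`.
  obtain ⟨P, p, hp, hab, lift⟩ := hE.exists_inserter a b
  obtain ⟨u, hu⟩ := lift e h
  obtain ⟨w, hw⟩ := he.exists_lift hp (a := u) (b := 𝟙 Y) (by rw [hu, Category.comp_id])
  simpa only [← Category.assoc, hw, Category.id_comp] using comp_le_left w hab

theorem IsSo.eq_of_comp_eq (hE : IsLex E) {X Y Z : E} {e : X ⟶ Y} (he : IsSo e) {a b : Y ⟶ Z}
    (h : e ≫ a = e ≫ b) : a = b :=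
  le_antisymm (he.le_of_comp_le hE h.le) (he.le_of_comp_le hE h.ge)

/-- Generalized elements lift locally along `so`-morphisms. -/
theorem IsRegularCat.exists_local_lift (hE : IsRegularCat E) {A X Y : E} {e : X ⟶ Y} (he : IsSo e)
    (a : A ⟶ Y) : ∃ (A' : E) (t : A' ⟶ A) (a' : A' ⟶ X), IsSo t ∧ a' ≫ e = t ≫ a := by
  obtain ⟨P, p₀, p₁, hP⟩ := IsLex.exists_pullback hE.lex a e
  exact ⟨P, p₀, p₁, hE.stable p₀ p₁ a e hP he, hP.1.1.symm⟩

/-- Finitely many local properties hold locally simultaneously. -/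
theorem IsRegularCat.exists_local_forall (hE : IsRegularCat E) {A : E} {ι : Type*} [Finite ι]
    (p : ι → ∀ A' : E, (A' ⟶ A) → Prop)
    (hp : ∀ i (A' A'' : E) (t : A' ⟶ A) (s : A'' ⟶ A'), p i A' t → p i A'' (s ≫ t))
    (h : ∀ i, ∃ (A' : E) (t : A' ⟶ A), IsSo t ∧ p i A' t) :
    ∃ (A' : E) (t : A' ⟶ A), IsSo t ∧ ∀ i, p i A' t := by
  suffices H : ∀ s : Set ι, s.Finite → ∃ (A' : E) (t : A' ⟶ A), IsSo t ∧ ∀ i ∈ s, p i A' t by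
    obtain ⟨A', t, ht, H⟩ := H Set.univ Set.finite_univ
    exact ⟨A', t, ht, fun i => H i trivial⟩
  intro s hs
  induction s, hs using Set.Finite.induction_on with
  | empty => exact ⟨A, 𝟙 A, isSo_id A, fun i hi => hi.elim⟩
  | @insert i s _ _ ih =>
    obtain ⟨A₁, t₁, ht₁, h₁⟩ := ih
    obtain ⟨A₂, t₂, ht₂, h₂⟩ := h i
    -- A common refinement of the covers `t₁` and `t₂`.
    obtain ⟨B, b, b', hb, e⟩ := hE.exists_local_lift ht₂ t₁
    refine ⟨B, b ≫ t₁, hb.comp ht₁, ?_⟩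
    rintro j (rfl | hj)
    · exact e ▸ hp _ _ _ _ _ h₂
    · exact hp _ _ _ _ _ (h₁ j hj)

/-- Morphisms which respect the kernel of an `so`-morphism descend along it. -/
theorem IsSo.exists_desc (hE : IsRegularCat E) {X Y Z : E} {e : X ⟶ Y} (he : IsSo e) (h : X ⟶ Z)
    (hh : ∀ ⦃A : E⦄ (a b : A ⟶ X), a ≫ e ≤ b ≫ e → a ≫ h ≤ b ≫ h) : ∃ u : Y ⟶ Z, e ≫ u = h := by
  -- The image of `(e, h) : X ⟶ Y × Z` turns out to be the graph of the required morphism.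
  obtain ⟨P, p₀, p₁, hP, lift⟩ := IsLex.exists_prod hE.lex Y Z
  obtain ⟨f, hf₀, hf₁⟩ := lift e h
  obtain ⟨I, e', m, he', hm, rfl⟩ := hE.factor f
  rw [Category.assoc] at hf₀ hf₁
  -- Elements of the image lift locally to `X`, where an inequality after `e` implies one after `h`.
  -- The projection to `Y` is also `so`, as a right factor of `e`, hence invertible.
  have hm₀ : OrderMono (m ≫ p₀) := by
    intro A x y hxy
    obtain ⟨A₁, t₁, x', ht₁, hx'⟩ := hE.exists_local_lift he' x
    obtain ⟨A₂, t₂, y', ht₂, hy'⟩ := hE.exists_local_lift he' (t₁ ≫ y)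
    refine (ht₂.comp ht₁).le_of_comp_le hE.lex ?_
    have hx₂ : (t₂ ≫ x') ≫ e' = (t₂ ≫ t₁) ≫ x := by rw [Category.assoc, hx', Category.assoc]
    have hy₂ : y' ≫ e' = (t₂ ≫ t₁) ≫ y := by rw [hy', Category.assoc]
    rw [← hx₂, ← hy₂]
    have key : (t₂ ≫ x') ≫ e ≤ y' ≫ e := by
      rw [← hf₀, ← Category.assoc, hx₂, ← Category.assoc y', hy₂, Category.assoc, Category.assoc _ y]
      exact comp_le_left _ hxy
    refine hm _ _ (hP _ _ ?_ ?_)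
    · simpa only [Category.assoc, hf₀] using key
    · simpa only [Category.assoc, hf₁] using hh _ _ key
  have hs₀ : IsSo (m ≫ p₀) := IsSo.of_comp (e := e') (hf₀.symm ▸ he)
  obtain ⟨w, hw₁, -⟩ := hs₀.exists_inverse hm₀
  refine ⟨w ≫ m ≫ p₁, ?_⟩
  rw [← hf₀]
  calc (e' ≫ m ≫ p₀) ≫ w ≫ m ≫ p₁ = e' ≫ ((m ≫ p₀) ≫ w) ≫ m ≫ p₁ := by
        simp only [Category.assoc]
    _ = h := by rw [hw₁, Category.id_comp, hf₁]

end Regular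

/-! ### The relation given by a pseudocongruence -/

section Rel

variable {C : Type u} [Category.{v} C] [PosCategory C]

/-- Two generalized elements are related if they factor through the pseudocongruence. -/
def Pseudocongruence.Rel (S : Pseudocongruence C) {A : C} (a b : A ⟶ S.X) : Prop :=
  ∃ u : A ⟶ S.R, u ≫ S.r₀ = a ∧ u ≫ S.r₁ = b

namespace Pseudocongruence

variable (S : Pseudocongruence C)

theorem rel_of_le {A : C} {a b : A ⟶ S.X} (h : a ≤ b) : S.Rel a b := S.orderRefl a b h

theorem rel_self : S.Rel S.r₀ S.r₁ := ⟨𝟙 _, Category.id_comp _, Category.id_comp _⟩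

variable {S}

theorem Rel.trans {A : C} {a b c : A ⟶ S.X} (h : S.Rel a b) (h' : S.Rel b c) : S.Rel a c := by
  obtain ⟨σ, rfl, hσ⟩ := h
  obtain ⟨ρ, hρ, rfl⟩ := h'
  obtain ⟨P, d₀, d₁, ⟨-, hP⟩, τ, hτ₀, hτ₁⟩ := S.trans
  obtain ⟨u, rfl, rfl⟩ := hP σ ρ (hσ.trans hρ.symm)
  exact ⟨u ≫ τ, by rw [Category.assoc, hτ₀, Category.assoc],
    by rw [Category.assoc, hτ₁, Category.assoc]⟩

theorem Rel.precomp {A B : C} {a b : A ⟶ S.X} (h : S.Rel a b) (t : B ⟶ A) :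
    S.Rel (t ≫ a) (t ≫ b) := by
  obtain ⟨u, rfl, rfl⟩ := h
  exact ⟨t ≫ u, Category.assoc _ _ _, Category.assoc _ _ _⟩

end Pseudocongruence

/-- A pair of morphisms which induces preorders containing the given orders is a
pseudocongruence. -/
def Pseudocongruence.ofRel [WeaklyLex C] {X R : C} (r₀ r₁ : R ⟶ X)
    (refl : ∀ ⦃A : C⦄ (a b : A ⟶ X), a ≤ b → ∃ u : A ⟶ R, u ≫ r₀ = a ∧ u ≫ r₁ = b)
    (trans : ∀ ⦃A : C⦄ (a b c : A ⟶ X), (∃ u : A ⟶ R, u ≫ r₀ = a ∧ u ≫ r₁ = b) →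
      (∃ u : A ⟶ R, u ≫ r₀ = b ∧ u ≫ r₁ = c) → ∃ u : A ⟶ R, u ≫ r₀ = a ∧ u ≫ r₁ = c) :
    Pseudocongruence C where
  X := X
  R := R
  r₀ := r₀
  r₁ := r₁
  orderRefl := refl
  trans := by
    obtain ⟨P, d₀, d₁, hP⟩ := exists_weakPullback r₁ r₀
    exact ⟨P, d₀, d₁, hP, trans _ _ _ ⟨d₀, rfl, rfl⟩ ⟨d₁, hP.1.symm, rfl⟩⟩

theorem WeakCommaId.rel_iff [WeaklyLex C] {X : C} (i : WeakCommaId X) {A : C} (a b : A ⟶ X) :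
    i.pseudocongruence.Rel a b ↔ a ≤ b := by
  refine ⟨?_, fun h => Pseudocongruence.rel_of_le (S := i.pseudocongruence) h⟩
  rintro ⟨u, rfl, rfl⟩
  exact comp_le_left u i.le

/-- A finite system of constraints, each in terms of the relation of a pseudocongruence. -/
structure RelSystem (J : MulticospanShape.{0, 0}) (C : Type u) [Category.{v} C]
    [PosCategory C] where
  left : J.L → C
  right : J.R → Pseudocongruence C
  fst : ∀ r, left (J.fst r) ⟶ (right r).X
  snd : ∀ r, left (J.snd r) ⟶ (right r).X

namespace RelSystem

variable {J : MulticospanShape.{0, 0}} (T : RelSystem J C)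

/-- The families `y` which satisfy the constraints. -/
def IsSolution {A : C} (y : ∀ l, A ⟶ T.left l) : Prop :=
  ∀ r, (T.right r).Rel (y (J.fst r) ≫ T.fst r) (y (J.snd r) ≫ T.snd r)

/-- The variable on one side of an equation between a constraint and its witness. -/
def node (J : MulticospanShape.{0, 0}) (r : J.R) : Bool → Bool → J.L ⊕ J.R
  | _, true => .inr r
  | false, false => .inl (J.fst r)
  | true, false => .inl (J.snd r)

/-- The shape of the system of inequalities expressing that witnesses for all constraints exist. -/
def witnessShape (J : MulticospanShape.{0, 0}) : MulticospanShape.{0, 0} where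
  L := J.L ⊕ J.R
  -- The first Boolean selects the equation for `r₀` or for `r₁`, the second the direction of the
  -- inequality.
  R := J.R × Bool × Bool
  fst r := node J r.1 r.2.1 r.2.2
  snd r := node J r.1 r.2.1 (!r.2.2)

instance [Finite J.L] [Finite J.R] : Finite (witnessShape J).L :=
  inferInstanceAs (Finite (J.L ⊕ J.R))

instance [Finite J.R] : Finite (witnessShape J).R :=
  inferInstanceAs (Finite (J.R × Bool × Bool))

/-- The types of the variables and witnesses. -/
def obj : J.L ⊕ J.R → C
  | .inl l => T.left l
  | .inr r => (T.right r).R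

/-- One side of an equation between a constraint and its witness. -/
def arr (r : J.R) : ∀ s k : Bool, T.obj (node J r s k) ⟶ (T.right r).X
  | false, true => (T.right r).r₀
  | true, true => (T.right r).r₁
  | false, false => T.fst r
  | true, false => T.snd r

/-- The system of inequalities expressing that witnesses for all constraints exist. -/
def witnessSystem : MulticospanIndex (witnessShape J) C where
  left := T.obj
  right r := (T.right r.1).X
  fst r := T.arr r.1 r.2.1 r.2.2
  snd r := T.arr r.1 r.2.1 (!r.2.2)

/-- Variables and witnesses together. -/
def join {D : Type*} [Category* D] {F : C → D} {A : D} (y : ∀ l, A ⟶ F (T.left l))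
    (w : ∀ r, A ⟶ F (T.right r).R) : ∀ l, A ⟶ F (T.obj l)
  | .inl l => y l
  | .inr r => w r

theorem isSolution_join {A : C} {y : ∀ l, A ⟶ T.left l} {w : ∀ r, A ⟶ (T.right r).R}
    (h₀ : ∀ r, w r ≫ (T.right r).r₀ = y (J.fst r) ≫ T.fst r)
    (h₁ : ∀ r, w r ≫ (T.right r).r₁ = y (J.snd r) ≫ T.snd r) :
    PosEnriched.IsSolution T.witnessSystem (T.join (F := id) y w) := by
  rintro ⟨r, _ | _, _ | _⟩
  exacts [(h₀ r).ge, (h₀ r).le, (h₁ r).ge, (h₁ r).le]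

theorem isSolution_map_join {E : Type u'} [Category.{v'} E] [PosCategory E] (F : PosFunctor C E)
    {A : E} {y : ∀ l, A ⟶ F.obj (T.left l)} {w : ∀ r, A ⟶ F.obj (T.right r).R}
    (h₀ : ∀ r, w r ≫ F.map (T.right r).r₀ = y (J.fst r) ≫ F.map (T.fst r))
    (h₁ : ∀ r, w r ≫ F.map (T.right r).r₁ = y (J.snd r) ≫ F.map (T.snd r)) :
    PosEnriched.IsSolution (mapSystem F.toFunctor T.witnessSystem)
      (T.join (F := F.obj) y w) := by
  rintro ⟨r, _ | _, _ | _⟩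
  exacts [(h₀ r).ge, (h₀ r).le, (h₁ r).ge, (h₁ r).le]

theorem isSolution_of_witness {A : C} {x : ∀ l, A ⟶ T.witnessSystem.left l}
    (hx : PosEnriched.IsSolution T.witnessSystem x) :
    T.IsSolution fun l => x (Sum.inl l) := fun r =>
  ⟨x (Sum.inr r), le_antisymm (hx (r, false, true)) (hx (r, false, false)),
    le_antisymm (hx (r, true, true)) (hx (r, true, false))⟩

/-- Witnesses are added as unknowns and then forgotten. They are not determined by the variables,
but weak universality survives this. -/
theorem exists_weakUniversal_solution [WeaklyLex C] [Finite J.L] [Finite J.R] :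
    ∃ (P : C) (x : ∀ l, P ⟶ T.left l), T.IsSolution x ∧
      ∀ ⦃A : C⦄ (y : ∀ l, A ⟶ T.left l), T.IsSolution y → ∃ u : A ⟶ P, ∀ l, u ≫ x l = y l := by
  obtain ⟨P, x, hx, lift⟩ := PosEnriched.exists_weakUniversal_solution T.witnessSystem
  refine ⟨P, fun l => x (Sum.inl l), T.isSolution_of_witness hx, fun A y hy => ?_⟩
  choose w h₀ h₁ using hy
  obtain ⟨u, hu⟩ := lift _ (T.isSolution_join h₀ h₁)
  exact ⟨u, fun l => hu (Sum.inl l)⟩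

end RelSystem

/-- Pseudocongruences can be pulled back along finite families of morphisms. -/
theorem Pseudocongruence.exists_inf [WeaklyLex C] {X : C} {ι : Type} [Finite ι]
    (S : ι → Pseudocongruence C) (g : ∀ j, X ⟶ (S j).X) :
    ∃ (R : C) (r₀ r₁ : R ⟶ X), ∀ ⦃A : C⦄ (a b : A ⟶ X),
      (∃ u : A ⟶ R, u ≫ r₀ = a ∧ u ≫ r₁ = b) ↔ ∀ j, (S j).Rel (a ≫ g j) (b ≫ g j) := by
  let J : MulticospanShape.{0, 0} := ⟨Bool, ι, fun _ => false, fun _ => true⟩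
  have : Finite J.L := inferInstanceAs (Finite Bool)
  have : Finite J.R := inferInstanceAs (Finite ι)
  let T : RelSystem J C := ⟨fun _ => X, S, g, g⟩
  obtain ⟨P, x, hx, lift⟩ := T.exists_weakUniversal_solution
  refine ⟨P, x false, x true, fun A a b => ⟨?_, fun h => ?_⟩⟩
  · rintro ⟨u, rfl, rfl⟩ j
    rw [Category.assoc, Category.assoc]
    exact (hx j).precomp u
  · let y : Bool → (A ⟶ X) := fun l => Bool.rec a b l
    obtain ⟨u, hu⟩ := lift y h
    exact ⟨u, hu false, hu true⟩

end Rel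

/-! ### Left covering functors -/

section LeftCovering

variable {C : Type u} [Category.{v} C] [PosCategory C]
  {E : Type u'} [Category.{v'} E] [PosCategory E] {F : PosFunctor C E}

/-- Local solutions of systems of inequalities over `F` come locally from solutions in `C`. -/
theorem PosFunctor.IsLeftCovering.exists_local_solution [WeaklyLex C] (hF : F.IsLeftCovering)
    (hE : IsRegularCat E) {J : MulticospanShape.{0, 0}} [Finite J.L] [Finite J.R]
    (S : MulticospanIndex J C) {A : E} (y : ∀ l, A ⟶ F.obj (S.left l))
    (hy : IsSolution (mapSystem F.toFunctor S) y) :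
    ∃ (P : C) (x : ∀ l, P ⟶ S.left l), IsSolution S x ∧
      ∃ (A' : E) (t : A' ⟶ A) (u : A' ⟶ F.obj P), IsSo t ∧
        ∀ l, u ≫ F.map (x l) = t ≫ y l := by
  have hW := isFiniteWeight_ineqWeight J
  obtain ⟨P, c, hc⟩ := WeaklyLex.exists_weakLimit (ineqWeight J) (ineqDiagram S) hW
  obtain ⟨M, m, hm⟩ := hE.lex (ineqWeight J) ((ineqDiagram S).comp F) hW
  obtain ⟨q, hq⟩ := (hm _).1 (c.map F)
  obtain ⟨a, ha⟩ := (hm _).1 (ineqCone ((ineqDiagram S).comp F) y hy)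
  -- The definition of left covering enters here: `q` is `so`, so the element `a` of the limit lifts
  -- locally to the image of the weak limit.
  obtain ⟨A', t, u, ht, hu⟩ :=
    hE.exists_local_lift (hF _ _ hW P c hc M m hm q hq).isSo a
  refine ⟨P, c.sol, c.sol_le, A', t, u, ht, fun l => ?_⟩
  have h₁ : q ≫ m.sol l = F.map (c.sol l) := congrArg (fun s => WCone.sol s l) hq
  have h₂ : a ≫ m.sol l = y l := congrArg (fun s => WCone.sol s l) ha
  exact (congrArg (u ≫ ·) h₁).symm.trans ((Category.assoc _ _ _).symm.trans
    ((congrArg (· ≫ m.sol l) hu).trans ((Category.assoc _ _ _).trans (congrArg (t ≫ ·) h₂))))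

variable (F) in
/-- Two generalized elements of `F X` are locally related if they locally factor through
the image of the pseudocongruence. -/
def LocRel (S : Pseudocongruence C) {A : E} (a b : A ⟶ F.obj S.X) : Prop :=
  ∃ (A' : E) (t : A' ⟶ A) (w : A' ⟶ F.obj S.R), IsSo t ∧
    w ≫ F.map S.r₀ = t ≫ a ∧ w ≫ F.map S.r₁ = t ≫ b

namespace LocRel

variable {S : Pseudocongruence C}

theorem of_local {A A' : E} {a b : A ⟶ F.obj S.X} {t : A' ⟶ A} (ht : IsSo t)
    (h : LocRel F S (t ≫ a) (t ≫ b)) : LocRel F S a b := by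
  obtain ⟨B, s, w, hs, h₀, h₁⟩ := h
  exact ⟨B, s ≫ t, w, hs.comp ht, by rw [h₀, Category.assoc], by rw [h₁, Category.assoc]⟩

theorem precomp (hE : IsRegularCat E) {A B : E} {a b : A ⟶ F.obj S.X} (h : LocRel F S a b)
    (x : B ⟶ A) : LocRel F S (x ≫ a) (x ≫ b) := by
  obtain ⟨A', t, w, ht, h₀, h₁⟩ := h
  obtain ⟨B', s, y, hs, e⟩ := hE.exists_local_lift ht x
  exact ⟨B', s, y ≫ w, hs, by rw [Category.assoc, h₀, ← Category.assoc, e, Category.assoc],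
    by rw [Category.assoc, h₁, ← Category.assoc, e, Category.assoc]⟩

theorem of_rel {P : C} {a b : P ⟶ S.X} (h : S.Rel a b) {A : E} (x : A ⟶ F.obj P) :
    LocRel F S (x ≫ F.map a) (x ≫ F.map b) := by
  obtain ⟨u, rfl, rfl⟩ := h
  exact ⟨A, 𝟙 A, x ≫ F.map u, isSo_id A, by simp, by simp⟩

end LocRel

/-- Solutions over `F` of systems of relational constraints, which hold locally, come locally from
solutions in `C`. -/
theorem PosFunctor.IsLeftCovering.exists_local_relSolution [WeaklyLex C] (hF : F.IsLeftCovering)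
    (hE : IsRegularCat E) {J : MulticospanShape.{0, 0}} [Finite J.L] [Finite J.R]
    (T : RelSystem J C) {A : E} (y : ∀ l, A ⟶ F.obj (T.left l))
    (hy : ∀ r, LocRel F (T.right r) (y (J.fst r) ≫ F.map (T.fst r))
      (y (J.snd r) ≫ F.map (T.snd r))) :
    ∃ (P : C) (x : ∀ l, P ⟶ T.left l), T.IsSolution x ∧
      ∃ (A' : E) (t : A' ⟶ A) (u : A' ⟶ F.obj P), IsSo t ∧
        ∀ l, u ≫ F.map (x l) = t ≫ y l := by
  obtain ⟨A₁, t₁, ht₁, h⟩ := hE.exists_local_forall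
    (fun r A' t => ∃ w : A' ⟶ F.obj (T.right r).R,
      w ≫ F.map (T.right r).r₀ = t ≫ y (J.fst r) ≫ F.map (T.fst r) ∧
      w ≫ F.map (T.right r).r₁ = t ≫ y (J.snd r) ≫ F.map (T.snd r))
    (by
      rintro r A' A'' t s ⟨w, h₀, h₁⟩
      exact ⟨s ≫ w, by rw [Category.assoc, h₀, Category.assoc],
        by rw [Category.assoc, h₁, Category.assoc]⟩)
    (fun r => by
      obtain ⟨A', t, w, ht, h⟩ := hy r
      exact ⟨A', t, ht, w, h⟩)
  choose w h₀ h₁ using h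
  obtain ⟨P, x, hx, A₂, t₂, u, ht₂, hu⟩ := hF.exists_local_solution hE T.witnessSystem
    (T.join (F := F.obj) (fun l => t₁ ≫ y l) w)
    (T.isSolution_map_join F (fun r => (h₀ r).trans (Category.assoc _ _ _).symm)
      (fun r => (h₁ r).trans (Category.assoc _ _ _).symm))
  exact ⟨P, fun l => x (Sum.inl l), T.isSolution_of_witness hx, A₂, t₂ ≫ t₁, u, ht₂.comp ht₁,
    fun l => (hu (Sum.inl l)).trans (Category.assoc _ _ _).symm⟩

namespace LocRel

variable {S : Pseudocongruence C} [WeaklyLex C]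

/-- Locally the pair comes from an ordered pair in `C`, which the pseudocongruence contains. -/
theorem of_le (hF : F.IsLeftCovering) (hE : IsRegularCat E) {A : E} {a b : A ⟶ F.obj S.X}
    (h : a ≤ b) : LocRel F S a b := by
  let J : MulticospanShape.{0, 0} := ⟨Bool, Unit, fun _ => false, fun _ => true⟩
  have : Finite J.L := inferInstanceAs (Finite Bool)
  have : Finite J.R := inferInstanceAs (Finite Unit)
  let T : MulticospanIndex J C := ⟨fun _ => S.X, fun _ => S.X, fun _ => 𝟙 _, fun _ => 𝟙 _⟩
  obtain ⟨P, x, hx, A', t, u, ht, hu⟩ := hF.exists_local_solution hE T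
    (fun l => Bool.rec a b l) (fun r => comp_le_right h _)
  have hx' : x false ≤ x true := by simpa [T] using hx ()
  refine of_local ht ?_
  rw [← hu false, ← hu true]
  exact of_rel (S.rel_of_le hx') u

/-- The two local relations form a system in three unknowns; it is solved locally in `C`, where `S`
is transitive. -/
theorem trans (hF : F.IsLeftCovering) (hE : IsRegularCat E) {A : E} {a b c : A ⟶ F.obj S.X}
    (h : LocRel F S a b) (h' : LocRel F S b c) : LocRel F S a c := by
  let J : MulticospanShape.{0, 0} := ⟨Fin 3, Fin 2, Fin.castSucc, Fin.succ⟩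
  have : Finite J.L := inferInstanceAs (Finite (Fin 3))
  have : Finite J.R := inferInstanceAs (Finite (Fin 2))
  let T : RelSystem J C := ⟨fun _ => S.X, fun _ => S, fun _ => 𝟙 _, fun _ => 𝟙 _⟩
  obtain ⟨P, x, hx, A', t, u, ht, hu⟩ := hF.exists_local_relSolution hE T
    (![a, b, c]) (by
      intro r
      rw [F.map_id, Category.comp_id, Category.comp_id]
      match r with
      | 0 => exact h
      | 1 => exact h')
  have hx' : S.Rel (x 0) (x 2) := by
    have h₀ := hx 0
    have h₁ := hx 1
    rw [Category.comp_id, Category.comp_id] at h₀ h₁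
    exact h₀.trans h₁
  refine of_local ht ?_
  have e₀ : u ≫ F.map (x 0) = t ≫ a := hu 0
  have e₂ : u ≫ F.map (x 2) = t ≫ c := hu 2
  rw [← e₀, ← e₂]
  exact of_rel hx' u

end LocRel

/-! ### Quotients of the images of pseudocongruences -/

variable (F) in
/-- A quotient of the image of a pseudocongruence under a left covering functor. -/
structure IsQuotient (S : Pseudocongruence C) {Q : E} (q : F.obj S.X ⟶ Q) : Prop where
  so : IsSo q
  le : F.map S.r₀ ≫ q ≤ F.map S.r₁ ≫ q
  locRel : ∀ ⦃A : E⦄ (a b : A ⟶ F.obj S.X), a ≫ q ≤ b ≫ q → LocRel F S a b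

namespace IsQuotient

variable {S : Pseudocongruence C} {Q : E} {q : F.obj S.X ⟶ Q}

theorem le_of_rel (hq : IsQuotient F S q) {P : C} {a b : P ⟶ S.X} (h : S.Rel a b) :
    F.map a ≫ q ≤ F.map b ≫ q := by
  obtain ⟨u, rfl, rfl⟩ := h
  simpa only [F.map_comp, Category.assoc] using comp_le_left (F.map u) hq.le

/-- By `locRel`, an inequality after `q` is locally witnessed by `F S.R`, and `so`-covers reflect
inequalities; so `h` respects the kernel of `q`. -/
theorem exists_desc (hq : IsQuotient F S q) (hE : IsRegularCat E) {Z : E} (h : F.obj S.X ⟶ Z)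
    (hh : F.map S.r₀ ≫ h ≤ F.map S.r₁ ≫ h) : ∃ u : Q ⟶ Z, q ≫ u = h := by
  refine hq.so.exists_desc hE h fun A a b hab => ?_
  obtain ⟨A', t, w, ht, h₀, h₁⟩ := hq.locRel a b hab
  refine ht.le_of_comp_le hE.lex ?_
  rw [← Category.assoc, ← Category.assoc, ← h₀, ← h₁, Category.assoc, Category.assoc]
  exact comp_le_left w hh

end IsQuotient

/-- The image `K` of `F S.R` in `F S.X × F S.X` is a congruence because `F` is left covering, and
exactness realizes it as a kernel. -/
theorem PosFunctor.IsLeftCovering.exists_isQuotient [WeaklyLex C] (hF : F.IsLeftCovering)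
    (hE : IsExactCat E) (S : Pseudocongruence C) :
    ∃ (Q : E) (q : F.obj S.X ⟶ Q), IsQuotient F S q := by
  have hR := hE.regular
  obtain ⟨P, p₀, p₁, hP, lift⟩ := IsLex.exists_prod hR.lex (F.obj S.X) (F.obj S.X)
  obtain ⟨f, hf₀, hf₁⟩ := lift (F.map S.r₀) (F.map S.r₁)
  obtain ⟨K, e, m, he, hm, rfl⟩ := hR.factor f
  rw [Category.assoc] at hf₀ hf₁
  -- The elements of `K` are the locally related pairs, which turns the congruence axioms into
  -- properties of `LocRel`.
  have mem : ∀ ⦃A : E⦄ (a b : A ⟶ F.obj S.X),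
      LocRel F S a b ↔ ∃ k : A ⟶ K, k ≫ m ≫ p₀ = a ∧ k ≫ m ≫ p₁ = b := by
    refine fun A a b => ⟨?_, ?_⟩
    · rintro ⟨A', t, w, ht, h₀, h₁⟩
      obtain ⟨c, hc₀, hc₁⟩ := lift a b
      have key : (w ≫ e) ≫ m = t ≫ c := by
        refine le_antisymm (hP _ _ ?_ ?_) (hP _ _ ?_ ?_) <;>
        · simp only [Category.assoc, hf₀, hf₁, hc₀, hc₁, h₀, h₁, le_refl]
      obtain ⟨k, hk⟩ := ht.exists_lift hm key
      exact ⟨k, by rw [← Category.assoc, hk, hc₀], by rw [← Category.assoc, hk, hc₁]⟩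
    · rintro ⟨k, rfl, rfl⟩
      obtain ⟨A', t, w, ht, hw⟩ := hR.exists_local_lift he k
      refine ⟨A', t, w, ht, ?_, ?_⟩
      · rw [← hf₀, ← Category.assoc, hw, Category.assoc]
      · rw [← hf₁, ← Category.assoc, hw, Category.assoc]
  have hK : IsCongruence (m ≫ p₀) (m ≫ p₁) := by
    refine ⟨fun A h h' h₀ h₁ => hm _ _ (hP _ _ ?_ ?_), fun A x => ?_, fun A a b h => ?_,
      fun A a x y hx hy => ?_⟩
    · simpa only [Category.assoc] using h₀
    · simpa only [Category.assoc] using h₁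
    · exact (mem x x).1 (.of_le hF hR le_rfl)
    · exact (mem _ _).1 (((mem _ _).2 ⟨a, rfl, rfl⟩).trans hF hR ((mem _ _).2 ⟨b, h.symm, rfl⟩))
    · exact (mem _ _).1 (((LocRel.of_le hF hR hx).trans hF hR
        ((mem _ _).2 ⟨a, rfl, rfl⟩)).trans hF hR (.of_le hF hR hy))
  obtain ⟨Y, g, ⟨hg, hg'⟩, -⟩ := hE.effective _ _ hK
  -- Dropping the order-mono `n` leaves the kernel unchanged and makes the quotient map `so`.
  obtain ⟨Q, q, n, hq, hn, rfl⟩ := hR.factor g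
  refine ⟨Q, q, hq, hn _ _ ?_, fun A a b hab => (mem a b).2 (hg' a b ?_)⟩
  · rw [← hf₀, ← hf₁]
    simpa only [Category.assoc] using comp_le_left e hg
  · simpa only [Category.assoc] using comp_le_right hab n

end LeftCovering

/-! ### Morphisms of the exact completion -/

section ExCompletion

variable {C : Type u} [Category.{v} C] [PosCategory C]

namespace ExCompletion

theorem homMk_comp_homMk {S T U : ExCompletion C} {f : S.X ⟶ T.X} {g : T.X ⟶ U.X}
    (hf : T.Rel (S.r₀ ≫ f) (S.r₁ ≫ f)) (hg : U.Rel (T.r₀ ≫ g) (T.r₁ ≫ g)) :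
    homMk f hf ≫ homMk g hg =
      homMk (f ≫ g) (PreHom.comp (⟨f, hf⟩ : PreHom S T) (⟨g, hg⟩ : PreHom T U)).2 := rfl

theorem exists_homMk {S T : ExCompletion C} (φ : S ⟶ T) :
    ∃ (f : S.X ⟶ T.X) (hf : T.Rel (S.r₀ ≫ f) (S.r₁ ≫ f)), φ = homMk f hf := by
  obtain ⟨f, hf⟩ := φ
  exact ⟨f, hf, rfl⟩

variable [WeaklyLex C] (I : ∀ X : C, WeakCommaId X)

/-- The morphism `(P, I_P) ⟶ (X, R)` given by a generalized element of `X`. -/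
def elt {P : C} {S : ExCompletion C} (x : P ⟶ S.X) : (Γ I).obj P ⟶ S :=
  homMk (S := (Γ I).obj P) x (S.orderRefl _ _ (comp_le_right (I P).le x))

/-- The canonical morphism `(X, I_X) ⟶ (X, R)`. -/
def cover (S : ExCompletion C) : (Γ I).obj S.X ⟶ S := elt I (𝟙 S.X)

theorem elt_le_elt_iff {P : C} {S : ExCompletion C} {x y : P ⟶ S.X} :
    elt I x ≤ elt I y ↔ S.Rel x y := Iff.rfl

theorem elt_homMk {P : C} {S T : ExCompletion C} (x : P ⟶ S.X) {f : S.X ⟶ T.X}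
    (hf : T.Rel (S.r₀ ≫ f) (S.r₁ ≫ f)) : elt I x ≫ homMk f hf = elt I (x ≫ f) := rfl

theorem map_elt {P Q : C} {S : ExCompletion C} (y : P ⟶ Q) (x : Q ⟶ S.X) :
    (Γ I).map y ≫ elt I x = elt I (y ≫ x) := rfl

theorem map_cover {P : C} {S : ExCompletion C} (x : P ⟶ S.X) :
    (Γ I).map x ≫ cover I S = elt I x := by
  rw [cover, map_elt, Category.comp_id]

theorem cover_homMk {S T : ExCompletion C} {f : S.X ⟶ T.X}
    (hf : T.Rel (S.r₀ ≫ f) (S.r₁ ≫ f)) : cover I S ≫ homMk f hf = elt I f := by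
  rw [cover, elt_homMk, Category.id_comp]

/-- The cover is represented by an identity, so precomposing with it keeps the representative. -/
theorem le_of_cover_comp_le {S T : ExCompletion C} {φ ψ : S ⟶ T}
    (h : cover I S ≫ φ ≤ cover I S ≫ ψ) : φ ≤ ψ := by
  obtain ⟨f, hf, rfl⟩ := exists_homMk φ
  obtain ⟨g, hg, rfl⟩ := exists_homMk ψ
  rw [cover_homMk, cover_homMk] at h
  exact h

theorem elt_r₀_le_elt_r₁ (S : ExCompletion C) : elt I S.r₀ ≤ elt I S.r₁ := S.rel_self

/-- A representative of `a` respects the relation of `S`, since this can be tested after the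
order-mono `m`; the same representative then gives the diagonal. -/
theorem isSo_cover (S : ExCompletion C) : IsSo (cover I S) := by
  refine isSo_of_lift fun U V m hm a b h => ?_
  obtain ⟨f, hf, rfl⟩ := exists_homMk a
  have key : U.Rel (S.r₀ ≫ f) (S.r₁ ≫ f) := by
    have : (Γ I).map S.r₀ ≫ homMk f hf ≤ (Γ I).map S.r₁ ≫ homMk f hf := by
      refine hm _ _ ?_
      rw [Category.assoc, Category.assoc, h, ← Category.assoc, ← Category.assoc, map_cover,
        map_cover]
      exact comp_le_right (elt_r₀_le_elt_r₁ I S) b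
    exact this
  refine ⟨homMk f key, ?_⟩
  have e : cover I S ≫ homMk f key = homMk f hf := cover_homMk I key
  have e' : cover I S ≫ homMk f key ≫ m = cover I S ≫ b := by rw [← Category.assoc, e, h]
  exact le_antisymm (le_of_cover_comp_le I e'.le) (le_of_cover_comp_le I e'.ge)

/-- An `so`-morphism of the exact completion has a section up to the target relation. -/
theorem exists_section_of_isSo {S T : ExCompletion C} {f : S.X ⟶ T.X}
    {hf : T.Rel (S.r₀ ≫ f) (S.r₁ ≫ f)} (h : IsSo (homMk f hf)) :
    ∃ g : T.X ⟶ S.X, T.Rel (g ≫ f) (𝟙 _) ∧ T.Rel (𝟙 _) (g ≫ f) := by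
  -- `S'` is `S.X` with the relation of `T` pulled back along `f`. The given morphism factors
  -- through it by an order-mono `m`, so `𝟙 T` lifts along `m`; a representative of the lift is the
  -- section.
  obtain ⟨R, r₀, r₁, hR⟩ := Pseudocongruence.exists_inf (fun _ : Unit => T) fun _ => f
  let S' : Pseudocongruence C := .ofRel r₀ r₁
    (fun A a b hab => (hR a b).2 fun _ => T.rel_of_le (comp_le_right hab f))
    (fun A a b c hab hbc => (hR a c).2 fun j => ((hR a b).1 hab j).trans ((hR b c).1 hbc j))
  have hS' : ∀ ⦃A : C⦄ (a b : A ⟶ S.X), S'.Rel a b ↔ T.Rel (a ≫ f) (b ≫ f) :=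
    fun A a b => (hR a b).trans ⟨fun h => h (), fun h _ => h⟩
  have he : T.Rel ((S.r₀ ≫ 𝟙 S.X) ≫ f) ((S.r₁ ≫ 𝟙 S.X) ≫ f) := by
    simpa only [Category.comp_id] using hf
  let e : S ⟶ S' := homMk (S := S) (T := S') (𝟙 S.X) ((hS' _ _).2 he)
  let m : S' ⟶ T := homMk (S := S') (T := T) f ((hS' _ _).1 S'.rel_self)
  have hm : OrderMono m := by
    intro Z φ ψ hφψ
    obtain ⟨x, hx, rfl⟩ := exists_homMk φ
    obtain ⟨y, hy, rfl⟩ := exists_homMk ψ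
    exact (hS' x y).2 hφψ
  have hem : e ≫ m = homMk f hf ≫ 𝟙 T := by
    rw [Category.comp_id]
    change homMk (𝟙 S.X ≫ f) _ = _
    congr 1
    exact Category.id_comp f
  obtain ⟨w, hw⟩ := h.exists_lift hm hem
  obtain ⟨g, hg, rfl⟩ := exists_homMk w
  exact ⟨g, hw.le, hw.ge⟩

/-- The canonical morphisms `(X, I_X) ⟶ (X, R)` have comma squares with vertex covered
by `(R, I_R)`. -/
theorem exists_comma_cover (S : ExCompletion C) :
    ∃ (K : ExCompletion C) (k : (Γ I).obj S.R ⟶ K) (c₀ c₁ : K ⟶ (Γ I).obj S.X),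
      IsSo k ∧ k ≫ c₀ = (Γ I).map S.r₀ ∧ k ≫ c₁ = (Γ I).map S.r₁ ∧
        IsComma c₀ c₁ (cover I S) (cover I S) := by
  -- The vertex is `S.R` with elements compared through both legs into `S.X`. This makes the legs
  -- jointly order-monic, which they need not be on `(R, I_R)`.
  obtain ⟨R, r₀, r₁, hR⟩ := Pseudocongruence.exists_inf
    (fun _ : Bool => (Γ I).obj S.X) (fun j => (Bool.rec S.r₀ S.r₁ j : S.R ⟶ S.X))
  let K : Pseudocongruence C := .ofRel r₀ r₁
    (fun A a b hab => (hR a b).2 fun j => Pseudocongruence.rel_of_le _ (comp_le_right hab _))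
    (fun A a b c hab hbc => (hR a c).2 fun j => ((hR a b).1 hab j).trans ((hR b c).1 hbc j))
  have hK : ∀ ⦃A : C⦄ (a b : A ⟶ S.R),
      K.Rel a b ↔ a ≫ S.r₀ ≤ b ≫ S.r₀ ∧ a ≫ S.r₁ ≤ b ≫ S.r₁ := by
    intro A a b
    refine (hR a b).trans ⟨fun h => ⟨((I S.X).rel_iff _ _).1 (h false),
      ((I S.X).rel_iff _ _).1 (h true)⟩, fun h => ?_⟩
    rintro (_ | _)
    exacts [((I S.X).rel_iff _ _).2 h.1, ((I S.X).rel_iff _ _).2 h.2]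
  have hK' := (hK _ _).1 K.rel_self
  let c₀ : K ⟶ (Γ I).obj S.X := homMk (S := K) (T := (Γ I).obj S.X) S.r₀
    (((I S.X).rel_iff _ _).2 hK'.1)
  let c₁ : K ⟶ (Γ I).obj S.X := homMk (S := K) (T := (Γ I).obj S.X) S.r₁
    (((I S.X).rel_iff _ _).2 hK'.2)
  refine ⟨K, cover I K, c₀, c₁, isSo_cover I K, cover_homMk I _, cover_homMk I _,
    ⟨le_of_cover_comp_le I ?_, fun Z φ ψ h => ?_⟩, fun Z φ ψ h₀ h₁ => ?_⟩
  · rw [← Category.assoc, ← Category.assoc]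
    erw [cover_homMk I, cover_homMk I]
    exact (map_cover I S.r₀).le.trans ((elt_r₀_le_elt_r₁ I S).trans (map_cover I S.r₁).ge)
  · obtain ⟨f, hf, rfl⟩ := exists_homMk φ
    obtain ⟨g, hg, rfl⟩ := exists_homMk ψ
    -- The hypothesis on `φ` and `ψ` unfolds to a witness `w : Z.X ⟶ S.R`, which represents the
    -- lift.
    obtain ⟨w, rfl, rfl⟩ : S.Rel f g :=
      (congrArg₂ S.Rel (Category.comp_id f) (Category.comp_id g)).mp h
    refine ⟨homMk (S := Z) (T := K) w ((hK _ _).2 ⟨?_, ?_⟩), rfl, rfl⟩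
    · exact (Category.assoc _ _ _).le.trans
        ((((I S.X).rel_iff _ _).1 hf).trans (Category.assoc _ _ _).ge)
    · exact (Category.assoc _ _ _).le.trans
        ((((I S.X).rel_iff _ _).1 hg).trans (Category.assoc _ _ _).ge)
  · obtain ⟨f, hf, rfl⟩ := exists_homMk φ
    obtain ⟨g, hg, rfl⟩ := exists_homMk ψ
    exact (hK _ _).2 ⟨((I S.X).rel_iff _ _).1 h₀, ((I S.X).rel_iff _ _).1 h₁⟩

theorem fullyOrderFaithful_Γ : (Γ I).FullyOrderFaithful := by
  refine fun X Y => ⟨fun h => ?_, fun f g h => ((I Y).rel_iff f g).1 h⟩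
  obtain ⟨f, hf, rfl⟩ := exists_homMk h
  exact ⟨f, rfl⟩

end ExCompletion

/-- A comma square is the universal solution of one inequality in two unknowns. -/
theorem PosFunctor.IsRegular.exists_lift_comma {E : Type u'} [Category.{v'} E] [PosCategory E]
    {G : PosFunctor C E} (hG : G.IsRegular) {P X Y Z : C} {c₀ : P ⟶ X} {c₁ : P ⟶ Y} {f : X ⟶ Z}
    {g : Y ⟶ Z} (h : IsComma c₀ c₁ f g) {A : E} (a : A ⟶ G.obj X) (b : A ⟶ G.obj Y)
    (hab : a ≫ G.map f ≤ b ≫ G.map g) :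
    ∃ k : A ⟶ G.obj P, k ≫ G.map c₀ = a ∧ k ≫ G.map c₁ = b := by
  let J : MulticospanShape.{0, 0} := ⟨Bool, Unit, fun _ => false, fun _ => true⟩
  have : Finite J.L := inferInstanceAs (Finite Bool)
  have : Finite J.R := inferInstanceAs (Finite Unit)
  let S : MulticospanIndex J C := ⟨fun l => Bool.rec X Y l, fun _ => Z, fun _ => f, fun _ => g⟩
  let x : ∀ l, P ⟶ S.left l := fun l => match l with
    | false => c₀
    | true => c₁
  let y : ∀ l, A ⟶ G.obj (S.left l) := fun l => match l with
    | false => a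
    | true => b
  obtain ⟨k, hk⟩ := hG.exists_lift (S := S) (x := x) (fun _ => h.1.1)
    (fun B z hz => by
      obtain ⟨u, h₀, h₁⟩ := h.1.2 (z false) (z true) (hz ())
      refine ⟨u, ?_⟩
      rintro (_ | _)
      exacts [h₀, h₁])
    (fun B u u' huu => h.2 u u' (huu false) (huu true)) y (fun _ => hab)
  exact ⟨k, hk false, hk true⟩

end ExCompletion

/-! ### Functors on the exact completion -/

section Extension

open ExCompletion

variable {C : Type u} [Category.{v} C] [PosCategory C] [WeaklyLex C]
  {I : ∀ X : C, WeakCommaId X} {E : Type u'} [Category.{v'} E] [PosCategory E]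
  {F : PosFunctor C E} {G : PosFunctor (ExCompletion C) E}
  (β : (Γ I).toFunctor ⋙ G.toFunctor ≅ F.toFunctor)

/-- The comparison morphism `F X ⟶ G (X, R)` for an extension `G` of `F`. -/
def extCover (S : ExCompletion C) : F.obj S.X ⟶ G.obj S :=
  β.inv.app S.X ≫ G.map (cover I S)

theorem inv_app_elt {P : C} {S : ExCompletion C} (x : P ⟶ S.X) :
    β.inv.app P ≫ G.map (elt I x) = F.map x ≫ extCover β S := by
  rw [← map_cover, G.map_comp, extCover]
  exact (Category.assoc _ _ _).symm.trans
    ((congrArg (· ≫ _) (β.inv.naturality x).symm).trans (Category.assoc _ _ _))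

theorem extCover_homMk {S T : ExCompletion C} {f : S.X ⟶ T.X}
    (hf : T.Rel (S.r₀ ≫ f) (S.r₁ ≫ f)) :
    extCover β S ≫ G.map (homMk f hf) = F.map f ≫ extCover β T := by
  rw [← inv_app_elt, ← cover_homMk I hf, G.map_comp, extCover, Category.assoc]

theorem extCover_obj (X : C) : extCover β ((Γ I).obj X) = β.inv.app X :=
  (congrArg (β.inv.app X ≫ ·) (G.map_id _)).trans (Category.comp_id _)

/-- Regular extensions send pseudocongruences to quotients. -/
theorem PosFunctor.IsRegular.isQuotient (hG : G.IsRegular) (hE : IsRegularCat E)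
    (S : ExCompletion C) : IsQuotient F S (extCover β S) := by
  refine ⟨(isSo_of_iso (β.symm.app S.X)).comp (hG.map_so _ (isSo_cover I S)), ?_,
    fun A a b hab => ?_⟩
  · rw [← inv_app_elt, ← inv_app_elt]
    exact comp_le_left _ (G.map_mono (elt_r₀_le_elt_r₁ I S))
  -- `G` preserves the comma square of the cover and the `so`-morphism `k` onto its vertex, so an
  -- inequality after `extCover` is locally witnessed by `F S.R`.
  · obtain ⟨K, k, c₀, c₁, hk, hk₀, hk₁, hK⟩ := exists_comma_cover I S
    obtain ⟨z, hz₀, hz₁⟩ := hG.exists_lift_comma hK (a ≫ β.inv.app S.X) (b ≫ β.inv.app S.X)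
      (by simpa only [extCover, Category.assoc] using hab)
    obtain ⟨A', t, w, ht, hw⟩ := hE.exists_local_lift (hG.map_so k hk) z
    have key : ∀ (r : S.R ⟶ S.X) (c : K ⟶ (Γ I).obj S.X) (a : A ⟶ F.obj S.X),
        k ≫ c = (Γ I).map r → z ≫ G.map c = a ≫ β.inv.app S.X →
        (w ≫ β.hom.app S.R) ≫ F.map r = t ≫ a := by
      intro r c a hr hc
      have e : G.map ((Γ I).map r) ≫ β.hom.app S.X = β.hom.app S.R ≫ F.map r :=
        β.hom.naturality r
      rw [Category.assoc, ← e, ← hr, G.map_comp, Category.assoc, ← Category.assoc, hw,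
        Category.assoc, ← Category.assoc z, hc, Category.assoc]
      exact congrArg (t ≫ ·) ((congrArg (a ≫ ·) (β.inv_hom_id_app S.X)).trans
        (Category.comp_id a))
    exact ⟨A', t, w ≫ β.hom.app S.R, ht, key _ _ _ hk₀ hz₀, key _ _ _ hk₁ hz₁⟩

/-- Two regular extensions of a functor are isomorphic. -/
theorem exists_iso_of_isRegular (hE : IsRegularCat E) {G' : PosFunctor (ExCompletion C) E}
    (β' : (Γ I).toFunctor ⋙ G'.toFunctor ≅ F.toFunctor) (hG : G.IsRegular) (hG' : G'.IsRegular) :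
    ∃ θ : G.toFunctor ≅ G'.toFunctor,
      ∀ X : C, θ.hom.app ((Γ I).obj X) ≫ β'.hom.app X = β.hom.app X := by
  have hq := hG.isQuotient β hE
  have hq' := hG'.isQuotient β' hE
  -- Both objects are quotients of `F S.X` by `S`, so each comparison morphism descends along the
  -- other.
  choose φ hφ using fun S => (hq S).exists_desc hE (extCover β' S) (hq' S).le
  choose ψ hψ using fun S => (hq' S).exists_desc hE (extCover β S) (hq S).le
  let θ : G.toFunctor ≅ G'.toFunctor := NatIso.ofComponents
    (fun S =>
      { hom := φ S
        inv := ψ S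
        hom_inv_id := (hq S).so.eq_of_comp_eq hE.lex (by
          rw [← Category.assoc, hφ, hψ, Category.comp_id])
        inv_hom_id := (hq' S).so.eq_of_comp_eq hE.lex (by
          rw [← Category.assoc, hψ, hφ, Category.comp_id]) })
    (fun {S T} χ => (hq S).so.eq_of_comp_eq hE.lex (by
      obtain ⟨f, hf, rfl⟩ := exists_homMk χ
      rw [← Category.assoc, extCover_homMk, Category.assoc, hφ, ← Category.assoc, hφ,
        extCover_homMk]))
  refine ⟨θ, fun X => ?_⟩
  have h := hφ ((Γ I).obj X)
  rw [extCover_obj, extCover_obj] at h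
  have h' : φ ((Γ I).obj X) = β.hom.app X ≫ β'.inv.app X := by
    rw [← h]
    exact ((congrArg (· ≫ _) (β.hom_inv_id_app X)).trans (Category.id_comp _)).symm.trans
      (Category.assoc _ _ _)
  change φ ((Γ I).obj X) ≫ _ = _
  rw [h', Category.assoc]
  exact (congrArg (_ ≫ ·) (β'.inv_hom_id_app X)).trans (Category.comp_id _)

variable (I) in
/-- Left covering functors into exact categories extend to the exact completion. -/
theorem PosFunctor.IsLeftCovering.exists_extension (hF : F.IsLeftCovering) (hE : IsExactCat E) :
    ∃ (G : PosFunctor (ExCompletion C) E) (β : (Γ I).toFunctor ⋙ G.toFunctor ≅ F.toFunctor),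
      ∀ S, IsQuotient F S (extCover β S) := by
  have hR := hE.regular
  choose Q q hq using hF.exists_isQuotient hE
  have epi : ∀ {S : Pseudocongruence C} {Z : E} {a b : Q S ⟶ Z}, q S ≫ a = q S ≫ b → a = b :=
    fun h => (hq _).so.eq_of_comp_eq hR.lex h
  -- Quantifying over all representatives of `φ` makes functoriality a computation with any
  -- convenient one.
  have hmap : ∀ {S T : ExCompletion C} (φ : S ⟶ T), ∃ u : Q S ⟶ Q T,
      ∀ (f : S.X ⟶ T.X) (hf : T.Rel (S.r₀ ≫ f) (S.r₁ ≫ f)), φ = homMk f hf →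
        q S ≫ u = F.map f ≫ q T := by
    intro S T φ
    obtain ⟨f, hf, rfl⟩ := exists_homMk φ
    obtain ⟨u, hu⟩ := (hq S).exists_desc hR (F.map f ≫ q T) (by
      simpa only [F.map_comp, Category.assoc] using (hq T).le_of_rel hf)
    exact ⟨u, fun g hg e => hu.trans
      (le_antisymm ((hq T).le_of_rel e.le) ((hq T).le_of_rel e.ge))⟩
  choose m hm using @hmap
  let G : PosFunctor (ExCompletion C) E :=
    { obj := Q
      map := m
      map_id := fun S => epi (by
        rw [hm (𝟙 S) (𝟙 S.X) (by simpa using S.rel_self) rfl, F.map_id, Category.id_comp,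
          Category.comp_id])
      map_comp := fun {S T U} φ ψ => epi (by
        obtain ⟨f, hf, rfl⟩ := exists_homMk φ
        obtain ⟨g, hg, rfl⟩ := exists_homMk ψ
        rw [hm _ _ _ (homMk_comp_homMk hf hg), ← Category.assoc, hm _ f hf rfl, Category.assoc,
          hm _ g hg rfl, F.map_comp, Category.assoc])
      map_mono := fun {S T φ ψ} h => (hq S).so.le_of_comp_le hR.lex (by
        obtain ⟨f, hf, rfl⟩ := exists_homMk φ
        obtain ⟨g, hg, rfl⟩ := exists_homMk ψ
        rw [hm _ f hf rfl, hm _ g hg rfl]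
        exact (hq T).le_of_rel h) }
  -- On `Γ X` the relation is the order itself, which `F` preserves; hence the identity of `F X`
  -- descends and the quotient map is invertible.
  choose r hr using fun X : C => (hq ((Γ I).obj X)).exists_desc hR (𝟙 (F.obj X))
    ((Category.comp_id _).le.trans ((F.map_mono (I X).le).trans (Category.comp_id _).ge))
  let β : (Γ I).toFunctor ⋙ G.toFunctor ≅ F.toFunctor := NatIso.ofComponents
    (fun X =>
      { hom := r X
        inv := q ((Γ I).obj X)
        hom_inv_id := epi (((Category.assoc _ _ _).symm.trans ((congrArg (· ≫ _) (hr X)).trans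
          (Category.id_comp _))).trans (Category.comp_id _).symm)
        inv_hom_id := hr X })
    (fun {X Y} f => epi (by
      have e : q ((Γ I).obj X) ≫ m ((Γ I).map f) = F.map f ≫ q ((Γ I).obj Y) :=
        hm (S := (Γ I).obj X) (T := (Γ I).obj Y) _ f ((I Y).exists_lift _ _ (comp_le_right (I X).le f)) rfl
      have e₁ : (F.map f ≫ q ((Γ I).obj Y)) ≫ r Y = F.map f :=
        (Category.assoc _ _ _).trans ((congrArg (F.map f ≫ ·) (hr Y)).trans (Category.comp_id _))
      have e₂ : q ((Γ I).obj X) ≫ r X ≫ F.map f = F.map f :=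
        (Category.assoc _ _ _).symm.trans
          ((congrArg (· ≫ F.map f) (hr X)).trans (Category.id_comp _))
      exact ((Category.assoc _ _ _).symm.trans (congrArg (· ≫ r Y) e)).trans (e₁.trans e₂.symm)))
  refine ⟨G, β, fun S => ?_⟩
  have : extCover β S = q S := ((hm (cover I S) (𝟙 S.X) _ rfl).trans
    (congrArg (· ≫ q S) (F.map_id S.X))).trans (Category.id_comp _)
  rw [this]
  exact hq S

end Extension

/-! ### Weighted cones on representatives of isomorphism classes -/

section Representatives

variable {D : Type} [Category.{0} D] [PosCategory D] {C : Type u} [Category.{v} C] [PosCategory C]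
  {W : PosFunctor D PartOrd.{0}} {K : PosFunctor D C} {ι : Type*} {rep : ι → D}

theorem WCone.leg_eq_of_iso {X : C} (c : WCone W K X) {d d' : D} (e : d ≅ d') (w : W.obj d) :
    c.leg d w = c.leg d' ((W.map e.hom).hom w) ≫ K.map e.inv := by
  rw [c.naturality, Category.assoc, ← K.map_comp, e.hom_inv_id, K.map_id, Category.comp_id]

/-- A finite weight bounds only the number of isomorphism classes of objects; finite systems arise
by testing cones on representatives. -/
theorem WCone.le_of_rep_le (hrep : ∀ d, ∃ i, Nonempty (d ≅ rep i)) {X : C} {c c' : WCone W K X}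
    (h : ∀ i w, c.leg (rep i) w ≤ c'.leg (rep i) w) : c ≤ c' := by
  intro d w
  obtain ⟨i, ⟨e⟩⟩ := hrep d
  rw [c.leg_eq_of_iso e, c'.leg_eq_of_iso e]
  exact comp_le_right (h i _) _

/-- A weighted cone is determined by its restriction to representatives, which can be arbitrary. -/
theorem WCone.exists_of_rep (hrep : ∀ d, ∃ i, Nonempty (d ≅ rep i)) {X : C}
    (ℓ : ∀ i, W.obj (rep i) → (X ⟶ K.obj (rep i)))
    (hle : ∀ {i j} (k : rep i ⟶ rep j) (w : W.obj (rep i)) (w' : W.obj (rep j)),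
      (W.map k).hom w ≤ w' → ℓ i w ≫ K.map k ≤ ℓ j w')
    (hge : ∀ {i j} (k : rep i ⟶ rep j) (w : W.obj (rep i)) (w' : W.obj (rep j)),
      w' ≤ (W.map k).hom w → ℓ j w' ≤ ℓ i w ≫ K.map k) :
    ∃ c : WCone W K X, ∀ i w, c.leg (rep i) w = ℓ i w := by
  choose i e using hrep
  let e := fun d => (e d).some
  have nat : ∀ {i j} (k : rep i ⟶ rep j) (w : W.obj (rep i)),
      ℓ j ((W.map k).hom w) = ℓ i w ≫ K.map k := fun k w =>
    _root_.le_antisymm (hge k w _ le_rfl) (hle k w _ le_rfl)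
  have mono : ∀ i, Monotone (ℓ i) := by
    intro i w w' h
    have := hle (𝟙 (rep i)) w w' (by rw [W.map_id]; exact h)
    rwa [K.map_id, Category.comp_id] at this
  refine ⟨⟨fun d w => ℓ (i d) ((W.map (e d).hom).hom w) ≫ K.map (e d).inv,
    fun d w w' h => comp_le_right (mono _ ((W.map (e d).hom).hom.monotone h)) _,
    fun {d d'} k w => ?_⟩, fun j w => ?_⟩
  · have h := nat ((e d).inv ≫ k ≫ (e d').hom) ((W.map (e d).hom).hom w)
    have h' : (W.map ((e d).inv ≫ k ≫ (e d').hom)).hom ((W.map (e d).hom).hom w) =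
        (W.map (e d').hom).hom ((W.map k).hom w) := by
      have : W.map (e d).hom ≫ W.map ((e d).inv ≫ k ≫ (e d').hom) =
          W.map k ≫ W.map (e d').hom := by
        rw [← W.map_comp, ← W.map_comp, (e d).hom_inv_id_assoc]
      exact congrArg (fun f => f.hom w) this
    rw [h'] at h
    rw [h, Category.assoc, Category.assoc, ← K.map_comp, ← K.map_comp]
    simp only [Category.assoc, Iso.hom_inv_id, Category.comp_id]
  -- The index and isomorphism chosen for `rep j` need not be `j` and the identity; naturality of
  -- `ℓ` removes the transport.
  · change ℓ _ _ ≫ _ = _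
    rw [nat, Category.assoc, ← K.map_comp, Iso.hom_inv_id, K.map_id, Category.comp_id]

theorem IsFiniteWeight.exists_rep (hW : IsFiniteWeight W) :
    ∃ (ι : Type) (rep : ι → D), Finite ι ∧ ∀ d, ∃ i, Nonempty (d ≅ rep i) :=
  ⟨Quotient (isIsomorphicSetoid D), Quotient.out, hW.1, fun d => ⟨Quotient.mk _ d,
    Nonempty.map Iso.symm (Quotient.mk_out (s := isIsomorphicSetoid D) d)⟩⟩

end Representatives

/-! ### Regularity of extensions -/

section Regularity

open ExCompletion

variable {C : Type u} [Category.{v} C] [PosCategory C] [WeaklyLex C]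
  {I : ∀ X : C, WeakCommaId X} {E : Type u'} [Category.{v'} E] [PosCategory E]
  {F : PosFunctor C E} {G : PosFunctor (ExCompletion C) E}
  (β : (Γ I).toFunctor ⋙ G.toFunctor ≅ F.toFunctor)

/-- The section `g` in `C`, up to the relation of `T`, exhibits the map under study as a right
factor of the `so`-morphism `extCover β T`. -/
theorem isSo_map_of_isQuotient (hq : ∀ S, IsQuotient F S (extCover β S)) {S T : ExCompletion C}
    {e : S ⟶ T} (he : IsSo e) : IsSo (G.map e) := by
  obtain ⟨f, hf, rfl⟩ := exists_homMk e
  obtain ⟨g, hg₀, hg₁⟩ := exists_section_of_isSo he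
  have key : (F.map g ≫ extCover β S) ≫ G.map (homMk f hf) = extCover β T := by
    have h := le_antisymm ((hq T).le_of_rel hg₀) ((hq T).le_of_rel hg₁)
    rw [F.map_id, Category.id_comp] at h
    rw [Category.assoc, extCover_homMk, ← Category.assoc, ← F.map_comp, h]
  exact IsSo.of_comp (key.symm ▸ (hq T).so)

/-- Extensions which send pseudocongruences to quotients preserve finite jointly order-monic
families. -/
theorem le_of_forall_comp_map_le (hF : F.IsLeftCovering) (hE : IsRegularCat E)
    (hq : ∀ S, IsQuotient F S (extCover β S)) {ι : Type} [Finite ι] {L : ExCompletion C}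
    {T : ι → ExCompletion C} (φ : ∀ i, L ⟶ T i)
    (hφ : ∀ ⦃P : ExCompletion C⦄ (a b : P ⟶ L), (∀ i, a ≫ φ i ≤ b ≫ φ i) → a ≤ b)
    {A : E} (a b : A ⟶ G.obj L) (h : ∀ i, a ≫ G.map (φ i) ≤ b ≫ G.map (φ i)) : a ≤ b := by
  choose f hf hφf using fun i => exists_homMk (φ i)
  obtain rfl : φ = fun i => homMk (f i) (hf i) := funext hφf
  obtain ⟨A₁, t₁, a', ht₁, ha⟩ := hE.exists_local_lift (hq L).so a
  obtain ⟨A₂, t₂, b', ht₂, hb⟩ := hE.exists_local_lift (hq L).so (t₁ ≫ b)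
  have ha₂ : (t₂ ≫ a') ≫ extCover β L = (t₂ ≫ t₁) ≫ a := by
    rw [Category.assoc, ha, Category.assoc]
  have hb₂ : b' ≫ extCover β L = (t₂ ≫ t₁) ≫ b := by rw [hb, Category.assoc]
  let J : MulticospanShape.{0, 0} := ⟨Bool, ι, fun _ => false, fun _ => true⟩
  have : Finite J.L := inferInstanceAs (Finite Bool)
  have : Finite J.R := inferInstanceAs (Finite ι)
  let Sys : RelSystem J C := ⟨fun _ => L.X, T, f, f⟩
  let y : Bool → (A₂ ⟶ F.obj L.X) := fun l => Bool.rec (t₂ ≫ a') b' l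
  obtain ⟨P, x, hx, A₃, t₃, u, ht₃, hu⟩ := hF.exists_local_relSolution hE Sys y (fun i => by
    refine (hq (T i)).locRel _ _ ?_
    have e : ∀ {x : A₂ ⟶ F.obj L.X} {z : A ⟶ G.obj L}, x ≫ extCover β L = (t₂ ≫ t₁) ≫ z →
        (x ≫ F.map (f i)) ≫ extCover β (T i) = (t₂ ≫ t₁) ≫ z ≫ G.map (homMk (f i) (hf i)) := by
      intro x z hxz
      rw [Category.assoc, ← extCover_homMk β (hf i), ← Category.assoc, hxz, Category.assoc]
    exact (e ha₂).le.trans ((comp_le_left _ (h i)).trans (e hb₂).ge))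
  -- Joint order-monicity in `C_ex` is applied to elements with vertex `Γ P`, where the constraints
  -- solved in `C` are its hypothesis.
  have hx' : L.Rel (x false) (x true) := hφ (elt I (x false)) (elt I (x true)) hx
  have hu₀ : u ≫ F.map (x false) = t₃ ≫ t₂ ≫ a' := hu false
  have hu₁ : u ≫ F.map (x true) = t₃ ≫ b' := hu true
  refine (ht₃.comp (ht₂.comp ht₁)).le_of_comp_le hE.lex ?_
  have := comp_le_left u ((hq L).le_of_rel hx')
  rw [← Category.assoc, ← Category.assoc, hu₀, hu₁, Category.assoc, Category.assoc t₃, ha₂,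
    hb₂] at this
  simpa only [Category.assoc] using this

variable {D : Type} [Category.{0} D] [PosCategory D] {W : PosFunctor D PartOrd.{0}}
  {K : PosFunctor D (ExCompletion C)}

/-- Cones over the image of a finite diagram come locally from cones with vertex in `C`. -/
theorem exists_local_cone (hF : F.IsLeftCovering) (hE : IsRegularCat E)
    (hq : ∀ S, IsQuotient F S (extCover β S)) (hW : IsFiniteWeight W) {A : E}
    (s : WCone W (K.comp G) A) :
    ∃ (P : C) (c : WCone W K ((Γ I).obj P)) (A' : E) (t : A' ⟶ A) (u : A' ⟶ G.obj ((Γ I).obj P)),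
      IsSo t ∧ (c.map G).precomp u = s.precomp t := by
  obtain ⟨ι, rep, hι, hrep⟩ := hW.exists_rep
  have := hW.2.1
  have := hW.2.2
  obtain ⟨leg, hleg⟩ : ∃ leg : ∀ d, W.obj d → (A ⟶ G.obj (K.obj d)), ∀ d w, s.leg d w = leg d w :=
    ⟨s.leg, fun _ _ => rfl⟩
  have leg_mono : ∀ {d w w'}, w ≤ w' → leg d w ≤ leg d w' := fun {d w w'} h =>
    (hleg d w).ge.trans ((s.leg_mono d h).trans (hleg d w').le)
  have leg_nat : ∀ {d d'} (k : d ⟶ d') (w : W.obj d),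
      leg d' ((W.map k).hom w) = leg d w ≫ G.map (K.map k) := fun {d d'} k w =>
    (hleg d' _).symm.trans ((s.naturality k w).trans (congrArg (· ≫ G.map (K.map k)) (hleg d w)))
  choose κ hκ hκK using fun i j (k : rep i ⟶ rep j) => exists_homMk (K.map k)
  obtain ⟨A₁, t₁, ht₁, hy⟩ := hE.exists_local_forall
    (fun (z : Σ i, W.obj (rep i)) A' t => ∃ y : A' ⟶ F.obj (K.obj (rep z.1)).X,
      y ≫ extCover β _ = t ≫ leg (rep z.1) z.2)
    (by
      rintro z A' A'' t r ⟨y, hy⟩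
      exact ⟨r ≫ y, by rw [Category.assoc, hy, Category.assoc]⟩)
    (fun z => by
      obtain ⟨A', t, y, ht, hy⟩ := hE.exists_local_lift (hq (K.obj (rep z.1))).so
        (leg (rep z.1) z.2)
      exact ⟨A', t, ht, y, hy⟩)
  choose y hy using fun i w => hy ⟨i, w⟩
  -- Constraints are indexed by `k`, `w`, `w'` with `w'` comparable to `W(k)(w)`. Both directions
  -- together give naturality, since equality in `C_ex` means being related both ways; `k = 𝟙` gives
  -- monotonicity.
  let Z := Σ i j, (rep i ⟶ rep j) × W.obj (rep i) × W.obj (rep j)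
  let Le : Z → Prop := fun ⟨_, _, k, w, w'⟩ => (W.map k).hom w ≤ w'
  let Ge : Z → Prop := fun ⟨_, _, k, w, w'⟩ => w' ≤ (W.map k).hom w
  let src : Z → Σ i, W.obj (rep i) := fun ⟨i, _, _, w, _⟩ => ⟨i, w⟩
  let tgt : Z → Σ i, W.obj (rep i) := fun ⟨_, j, _, _, w'⟩ => ⟨j, w'⟩
  let J : MulticospanShape.{0, 0} := ⟨Σ i, W.obj (rep i), Subtype Le ⊕ Subtype Ge,
    Sum.elim (fun z => src z.1) (fun z => tgt z.1), Sum.elim (fun z => tgt z.1) (fun z => src z.1)⟩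
  have : Finite J.L := inferInstanceAs (Finite (Σ i, W.obj (rep i)))
  have : Finite J.R := inferInstanceAs (Finite (Subtype Le ⊕ Subtype Ge))
  let T : RelSystem J C :=
    { left := fun z => (K.obj (rep z.1)).X
      right := fun r => match r with
        | .inl ⟨⟨_, j, _⟩, _⟩ => K.obj (rep j)
        | .inr ⟨⟨_, j, _⟩, _⟩ => K.obj (rep j)
      fst := fun r => match r with
        | .inl ⟨⟨i, j, k, _⟩, _⟩ => κ i j k
        | .inr ⟨⟨_, _, _⟩, _⟩ => 𝟙 _
      snd := fun r => match r with
        | .inl ⟨⟨_, _, _⟩, _⟩ => 𝟙 _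
        | .inr ⟨⟨i, j, k, _⟩, _⟩ => κ i j k }
  have hsrc : ∀ {i j} (k : rep i ⟶ rep j) (w : W.obj (rep i)),
      (y i w ≫ F.map (κ i j k)) ≫ extCover β (K.obj (rep j)) =
        t₁ ≫ leg (rep j) ((W.map k).hom w) := by
    intro i j k w
    rw [leg_nat, Category.assoc, ← extCover_homMk β (hκ i j k), ← hκK, ← Category.assoc, hy,
      Category.assoc]
  have htgt : ∀ {j} (w : W.obj (rep j)),
      (y j w ≫ F.map (𝟙 _)) ≫ extCover β (K.obj (rep j)) = t₁ ≫ leg (rep j) w := by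
    intro j w
    rw [F.map_id, Category.comp_id, hy]
  obtain ⟨P, x, hx, A₂, t₂, u, ht₂, hu⟩ := hF.exists_local_relSolution hE T
    (fun z => y z.1 z.2) (by
      rintro (⟨⟨i, j, k, w, w'⟩, hz⟩ | ⟨⟨i, j, k, w, w'⟩, hz⟩)
      · refine (hq (K.obj (rep j))).locRel _ _ ?_
        exact (hsrc k w).le.trans ((comp_le_left _ (leg_mono hz)).trans (htgt w').ge)
      · refine (hq (K.obj (rep j))).locRel _ _ ?_
        exact (htgt w').le.trans ((comp_le_left _ (leg_mono hz)).trans (hsrc k w).ge))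
  obtain ⟨c, hc⟩ := WCone.exists_of_rep hrep (W := W) (K := K) (X := (Γ I).obj P)
    (fun i w => elt I (x ⟨i, w⟩))
    (fun {i j} k w w' h => by
      have h' := hx (.inl ⟨⟨i, j, k, w, w'⟩, h⟩)
      rw [hκK i j k, elt_homMk, elt_le_elt_iff]
      exact (congrArg ((K.obj (rep j)).Rel _) (Category.comp_id _)).mp h')
    (fun {i j} k w w' h => by
      have h' := hx (.inr ⟨⟨i, j, k, w, w'⟩, h⟩)
      rw [hκK i j k, elt_homMk, elt_le_elt_iff]
      exact (congrArg (fun a => (K.obj (rep j)).Rel a _) (Category.comp_id _)).mp h')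
  have hcs : ∀ i w, (u ≫ β.inv.app P) ≫ G.map (c.leg (rep i) w) =
      (t₂ ≫ t₁) ≫ leg (rep i) w := by
    intro i w
    have hu' : u ≫ F.map (x ⟨i, w⟩) = t₂ ≫ y i w := hu ⟨i, w⟩
    have e : β.inv.app P ≫ G.map (c.leg (rep i) w) =
        F.map (x ⟨i, w⟩) ≫ extCover β (K.obj (rep i)) := by
      rw [hc]
      exact inv_app_elt β _
    rw [Category.assoc, Category.assoc, ← hy, ← Category.assoc t₂, ← hu', Category.assoc]
    exact congrArg (u ≫ ·) e
  have hcs' : ∀ i w, (u ≫ β.inv.app P) ≫ G.map (c.leg (rep i) w) =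
      (t₂ ≫ t₁) ≫ s.leg (rep i) w := fun i w =>
    (hcs i w).trans (congrArg ((t₂ ≫ t₁) ≫ ·) (hleg _ w)).symm
  exact ⟨P, c, A₂, t₂ ≫ t₁, u ≫ β.inv.app P, ht₂.comp ht₁,
    WCone.le_antisymm (WCone.le_of_rep_le hrep fun i w => (hcs' i w).le)
      (WCone.le_of_rep_le hrep fun i w => (hcs' i w).ge)⟩

/-- Extensions of left covering functors which send pseudocongruences to quotients are regular. -/
theorem isRegular_of_isQuotient (hF : F.IsLeftCovering) (hE : IsRegularCat E)
    (hq : ∀ S, IsQuotient F S (extCover β S)) : G.IsRegular := by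
  refine ⟨fun {D} _ _ W K hW L c hc A => ?_, fun S T e he => isSo_map_of_isQuotient β hq he⟩
  have mono : ∀ {A : E} (u v : A ⟶ G.obj L),
      (c.map G).precomp u ≤ (c.map G).precomp v → u ≤ v := by
    intro A u v h
    obtain ⟨ι, rep, hι, hrep⟩ := hW.exists_rep
    have := hW.2.2
    exact le_of_forall_comp_map_le β hF hE hq
      (fun z : Σ i, W.obj (rep i) => c.leg (rep z.1) z.2)
      (fun P a b hab => (hc P).2 a b (WCone.le_of_rep_le hrep fun i w => hab ⟨i, w⟩)) u v
      (fun z => h (rep z.1) z.2)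
  refine ⟨fun s => ?_, mono⟩
  obtain ⟨P, c', A', t, u, ht, hu⟩ := exists_local_cone β hF hE hq hW s
  obtain ⟨v, rfl⟩ := (hc _).1 c'
  have huv : ∀ d w, (u ≫ G.map v) ≫ G.map (c.leg d w) = t ≫ s.leg d w := by
    intro d w
    rw [Category.assoc, ← G.map_comp]
    exact congrArg (fun r => WCone.leg r d w) hu
  -- The legs of `c.map G` are jointly order-monic, so the local factorization respects the kernel
  -- of `t` and descends to `A`.
  obtain ⟨z, hz⟩ := ht.exists_desc hE (u ≫ G.map v) (by
    intro B a b hab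
    refine mono _ _ fun d w => ?_
    have e : ∀ a : B ⟶ A', (a ≫ u ≫ G.map v) ≫ G.map (c.leg d w) = (a ≫ t) ≫ s.leg d w :=
      fun a => (Category.assoc _ _ _).trans
        ((congrArg (a ≫ ·) (huv d w)).trans (Category.assoc _ _ _).symm)
    exact (e a).le.trans ((comp_le_right hab _).trans (e b).ge))
  refine ⟨z, WCone.ext (funext fun d => funext fun w => ht.eq_of_comp_eq hE.lex ?_)⟩
  change t ≫ z ≫ G.map (c.leg d w) = _
  rw [← Category.assoc, hz, huv]

end Regularity

end PosEnriched

theorem mainTheorem2 {C : Type u} [Category.{v} C] [PosCategory C] [WeaklyLex C]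
    (I : ∀ X : C, WeakCommaId X)
    {E : Type u'} [Category.{v'} E] [PosCategory E] (hE : IsExactCat E)
    (F : PosFunctor C E) (hF : F.IsLeftCovering) :
    (Γ I).FullyOrderFaithful ∧
    ∃ (Fbar : PosFunctor (ExCompletion C) E) (α : (Γ I).toFunctor ⋙ Fbar.toFunctor ≅ F.toFunctor),
      Fbar.IsRegular ∧
      ∀ (G : PosFunctor (ExCompletion C) E) (β : (Γ I).toFunctor ⋙ G.toFunctor ≅ F.toFunctor),
        G.IsRegular →
        ∃ θ : Fbar.toFunctor ≅ G.toFunctor,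
          ∀ X : C, θ.hom.app ((Γ I).obj X) ≫ β.hom.app X = α.hom.app X := by
  obtain ⟨Fbar, α, hq⟩ := hF.exists_extension I hE
  have hFbar := isRegular_of_isQuotient α hF hE.regular hq
  exact ⟨ExCompletion.fullyOrderFaithful_Γ I, Fbar, α, hFbar,
    fun G β hG => exists_iso_of_isRegular α hE.regular β hFbar hG⟩
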